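/- Let $(\mathcal H_s)_{s\in\mathbb R}$ be a scale of complex Hilbert spaces with $\mathcal H_0=\mathcal H$: for $t\le s$, $\mathcal H_s$ is continuously embedded in $\mathcal H_t$, densely if $t<s$; $\|f\|_{\mathcal H}\le\|f\|_{\mathcal H_s}$ for $s>0$; and $\mathcal H_{-s}$ is the dual space of $\mathcal H_s$ with respect to the inner product $\langle\cdot,\cdot\rangle$ of $\mathcal H$. Let $C$ be an antiunitary involution of $\mathcal H$ which restricts or extends to a bounded map $\mathcal H_s\to\mathcal H_s$ for every $s\in\mathbb R$; an operator in $\mathcal H$ is called real if it commutes with $C$. Let $H$ be a (possibly unbounded) operator in $\mathcal H$, let $\lambda_0\in\mathbb R$, and assume: (H1) $H$ is real and self-adjoint. (H2) $\lambda_0$ is an eigenvalue of $H$ of finite multiplicity, it belongs to the continuous spectrum of $H$ (the spectrum of the part of $H$ in the orthogonal complement of all eigenvectors of $H$), it is isolated in the set of eigenvalues of $H$, and the corresponding eigenspace is contained in $\bigcap_{s\ge0}\mathcal H_s$. Let $P_0$ be the orthogonal projection in $\mathcal H$ onto the eigenspace of $H$ at $\lambda_0$, and let $\overline H=H+P_0$.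 (H3)$_1$ There is $s_1\ge0$ such that for every $s>s_1$ there is $\delta_1=\delta_1(s)>0$ such that the norm limits $(\overline H-\lambda\pm i0)^{-1}=\lim_{\epsilon\downarrow0}(\overline H-\lambda\pm i\epsilon)^{-1}$ exist in $\mathcal L(\mathcal H_s,\mathcal H_{-s})$ for all $\lambda\in(\lambda_0-\delta_1,\lambda_0+\delta_1)$ and are $C^1$ in $\lambda$ there in the norm topology. Fix $s>s_1$ and a compact interval $J_1\subset(\lambda_0-\delta_1(s),\lambda_0+\delta_1(s))$. Call $\gamma>0$ a threshold for $J_1$ if for every $W\in\mathcal L(\mathcal H_{-s},\mathcal H_s)$ which is real and self-adjoint as an operator in $\mathcal H$ and satisfies $\|W\|_{\mathcal L(\mathcal H_{-s},\mathcal H_s)}<\gamma$, the operators $(\overline H+W-\lambda\pm i\epsilon)^{-1}$ and their first derivatives with respect to $\lambda$ converge in $\mathcal L(\mathcal H_s,\mathcal H_{-s})$ as $\epsilon\downarrow0$, uniformly for $\lambda\in J_1$, to boundary values $(\overline H+W-\lambda\pm i0)^{-1}$ and the $\lambda$-derivatives of these on $J_1$. Then a threshold exists. Moreover, let $\gamma$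 be any threshold, let $W\in\mathcal L(\mathcal H_{-s},\mathcal H_s)$ be real and self-adjoint as an operator in $\mathcal H$ with $\|W\|_{\mathcal L(\mathcal H_{-s},\mathcal H_s)}<\gamma$, and let $\lambda\in J_1$. Then the norm limit $$Q(\lambda+i0,W)=\lim_{\epsilon\downarrow0}P_0(\overline H+W-\lambda-i\epsilon)^{-1}P_0=P_0(\overline H+W-\lambda-i0)^{-1}P_0$$ exists in $\mathcal L(\mathcal H)$, and $1$ is an eigenvalue of $Q(\lambda+i0,W)$ if and only if $\lambda$ is an eigenvalue of $H+W$. -/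

import Mathlib

open Set Filter Topology

universe u

noncomputable section

/-! ### Unbounded operators -/

section Unbounded

variable {E : Type u} [NormedAddCommGroup E] [InnerProductSpace ℂ E]

/-- `A + B` for an unbounded operator `A` and a bounded operator `B`; its domain is the domain
of `A`. -/
def addBounded (A : E →ₗ.[ℂ] E) (B : E →L[ℂ] E) : E →ₗ.[ℂ] E :=
  (B : E →ₗ[ℂ] E) +ᵥ A

/-- The eigenspace `{x ∈ Dom A : A x = z x}`. -/
def eigenspaceOf (A : E →ₗ.[ℂ] E) (z : ℂ) : Submodule ℂ E where
  carrier := {x | ∃ hx : x ∈ A.domain, A ⟨x, hx⟩ = z • x}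
  zero_mem' := ⟨A.domain.zero_mem, by
    have h : (⟨0, A.domain.zero_mem⟩ : A.domain) = 0 := rfl
    rw [h, LinearPMap.map_zero, smul_zero]⟩
  add_mem' := by
    rintro x y ⟨hx, hx'⟩ ⟨hy, hy'⟩
    refine ⟨A.domain.add_mem hx hy, ?_⟩
    have h : (⟨x + y, A.domain.add_mem hx hy⟩ : A.domain) = ⟨x, hx⟩ + ⟨y, hy⟩ := rfl
    rw [h, LinearPMap.map_add, hx', hy', smul_add]
  smul_mem' := by
    rintro c x ⟨hx, hx'⟩
    refine ⟨A.domain.smul_mem c hx, ?_⟩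
    have h : (⟨c • x, A.domain.smul_mem c hx⟩ : A.domain) = c • ⟨x, hx⟩ := rfl
    rw [h, LinearPMap.map_smul, hx', smul_comm]

/-- `z` is an eigenvalue of `A`. -/
def IsEigenvalueOf (A : E →ₗ.[ℂ] E) (z : ℂ) : Prop :=
  ∃ x : A.domain, (x : E) ≠ 0 ∧ A x = z • (x : E)

/-- The bounded operator `R` is the two-sided inverse of `A - z : Dom A → E`. -/
def IsResolventAt (A : E →ₗ.[ℂ] E) (z : ℂ) (R : E →L[ℂ] E) : Prop :=
  (∀ y : E, ∃ hy : R y ∈ A.domain, A ⟨R y, hy⟩ - z • R y = y) ∧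
    ∀ x : A.domain, R (A x - z • (x : E)) = x

/-- The spectrum of `A`. -/
def spectrumOf (A : E →ₗ.[ℂ] E) : Set ℂ :=
  {z | ¬ ∃ R : E →L[ℂ] E, IsResolventAt A z R}

open Classical in
/-- The resolvent `(A - z)⁻¹` (and `0` if `z` lies in the spectrum of `A`). -/
def resolventOf (A : E →ₗ.[ℂ] E) (z : ℂ) : E →L[ℂ] E :=
  if h : ∃ R : E →L[ℂ] E, IsResolventAt A z R then h.choose else 0

/-- The part of `A` in the subspace `K`: the restriction of `A` to
`{x ∈ K : x ∈ Dom A, A x ∈ K}`, as an operator acting in `K`. -/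
def partIn (A : E →ₗ.[ℂ] E) (K : Submodule ℂ E) : K →ₗ.[ℂ] K where
  domain :=
    { carrier := {x | ∃ hx : (x : E) ∈ A.domain, A ⟨x, hx⟩ ∈ K}
      zero_mem' := ⟨A.domain.zero_mem, by
        have h : (⟨((0 : K) : E), A.domain.zero_mem⟩ : A.domain) = 0 := rfl
        rw [h, LinearPMap.map_zero]; exact K.zero_mem⟩
      add_mem' := by
        rintro x y ⟨hx, hx'⟩ ⟨hy, hy'⟩
        refine ⟨A.domain.add_mem hx hy, ?_⟩
        have h : (⟨((x + y : K) : E), A.domain.add_mem hx hy⟩ : A.domain)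
            = ⟨x, hx⟩ + ⟨y, hy⟩ := rfl
        rw [h, LinearPMap.map_add]; exact K.add_mem hx' hy'
      smul_mem' := by
        rintro c x ⟨hx, hx'⟩
        refine ⟨A.domain.smul_mem c hx, ?_⟩
        have h : (⟨((c • x : K) : E), A.domain.smul_mem c hx⟩ : A.domain)
            = c • ⟨x, hx⟩ := rfl
        rw [h, LinearPMap.map_smul]; exact K.smul_mem c hx' }
  toFun :=
    { toFun := fun x => ⟨A ⟨((x : K) : E), x.2.choose⟩, x.2.choose_spec⟩
      map_add' := fun x y => Subtype.ext
        (A.map_add ⟨((x : K) : E), x.2.choose⟩ ⟨((y : K) : E), y.2.choose⟩)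
      map_smul' := fun c x => Subtype.ext (A.map_smul c ⟨((x : K) : E), x.2.choose⟩) }

/-- The continuous spectrum: the spectrum of the part of `A` in the orthogonal complement of the
span of all eigenvectors of `A`. -/
def continuousSpectrumOf (A : E →ₗ.[ℂ] E) : Set ℂ :=
  spectrumOf (partIn A (⨆ z : ℂ, eigenspaceOf A z)ᗮ)

/-- The orthogonal projection onto the eigenspace of `A` at `z`. The closure only serves to make
the definition total: the eigenspace is closed when `A` is self-adjoint or when it has finite
dimension. -/
def eigenprojection [CompleteSpace E] (A : E →ₗ.[ℂ] E) (z : ℂ) : E →L[ℂ] E :=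
  (eigenspaceOf A z).topologicalClosure.starProjection

/-- `A + P`, where `P` is the orthogonal projection onto the eigenspace of `A` at `z`. -/
def shifted [CompleteSpace E] (A : E →ₗ.[ℂ] E) (z : ℂ) : E →ₗ.[ℂ] E :=
  addBounded A (eigenprojection A z)

end Unbounded

/-! ### Scales of Hilbert spaces -/

section Scale

variable (X : ℝ → Type u) [∀ s, NormedAddCommGroup (X s)] [∀ s, InnerProductSpace ℂ (X s)]
  [∀ s, CompleteSpace (X s)]

/-- A scale of Hilbert spaces `X s`, `s ∈ ℝ`, over the Hilbert space `X 0`: for `t ≤ s` the space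
`X s` is continuously embedded in `X t`, densely if `t < s`, and `X (-s)` is the dual space of
`X s` with respect to the inner product of `X 0`. -/
structure HilbertScale where
  /-- The embedding of `X s` into `X t` for `t ≤ s`. -/
  emb : ∀ {s t : ℝ}, t ≤ s → (X s →L[ℂ] X t)
  emb_refl : ∀ (s : ℝ) (f : X s), emb (le_refl s) f = f
  emb_trans : ∀ {r s t : ℝ} (hrs : s ≤ r) (hst : t ≤ s) (f : X r),
    emb hst (emb hrs f) = emb (hst.trans hrs) f
  emb_injective : ∀ {s t : ℝ} (h : t ≤ s), Function.Injective (emb h)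
  emb_dense : ∀ {s t : ℝ} (h : t < s), DenseRange (emb h.le)
  norm_emb_le : ∀ {s : ℝ} (h : 0 < s) (f : X s), ‖emb h.le f‖ ≤ ‖f‖
  /-- The identification of `X (-s)` with the dual space of `X s`; `pairing s u f` is the duality
  pairing `⟨u, f⟩`, conjugate-linear in `u` and linear in `f`. -/
  pairing : ∀ s : ℝ, X (-s) ≃SL[starRingEnd ℂ] (StrongDual ℂ (X s))
  pairing_nonneg : ∀ {s : ℝ} (hs : 0 ≤ s) (u : X 0) (f : X s),
    pairing s (emb (neg_nonpos.2 hs) u) f = inner ℂ u (emb hs f)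
  pairing_nonpos : ∀ {s : ℝ} (hs : s ≤ 0) (u : X (-s)) (f : X 0),
    pairing s u (emb hs f) = inner ℂ (emb (neg_nonneg.2 hs) u) f

variable {X}

namespace HilbertScale

/-- An antiunitary involution of `X 0` which restricts (`s > 0`) or extends (`s < 0`) to a bounded
map of every `X s`. -/
structure Conjugation (S : HilbertScale X) where
  /-- The map on `X s`. -/
  conj : ∀ s : ℝ, X s →SL[starRingEnd ℂ] X s
  conj_conj : ∀ f : X 0, conj 0 (conj 0 f) = f
  inner_conj_conj : ∀ f g : X 0, inner ℂ (conj 0 f) (conj 0 g) = starRingEnd ℂ (inner ℂ f g)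
  conj_emb : ∀ {s t : ℝ} (h : t ≤ s) (f : X s), conj t (S.emb h f) = S.emb h (conj s f)

variable (S : HilbertScale X)

/-- A bounded operator in `X 0`, regarded as an operator from `X s` to `X (-s)`, `s ≥ 0`. -/
def toDualOp {s : ℝ} (hs : 0 ≤ s) (T : X 0 →L[ℂ] X 0) : X s →L[ℂ] X (-s) :=
  (S.emb (neg_nonpos.2 hs)).comp (T.comp (S.emb hs))

/-- A bounded operator from `X (-s)` to `X s`, regarded as an operator in `X 0`, `s ≥ 0`. -/
def toOp {s : ℝ} (hs : 0 ≤ s) (W : X (-s) →L[ℂ] X s) : X 0 →L[ℂ] X 0 :=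
  (S.emb hs).comp (W.comp (S.emb (neg_nonpos.2 hs)))

/-- The resolvent `(A - z)⁻¹`, regarded as an operator from `X s` to `X (-s)`, `s ≥ 0`. -/
def scaleResolvent {s : ℝ} (hs : 0 ≤ s) (A : X 0 →ₗ.[ℂ] X 0) (z : ℂ) : X s →L[ℂ] X (-s) :=
  S.toDualOp hs (resolventOf A z)

/-- (H1): `H` is real and self-adjoint. -/
structure H1 (C : S.Conjugation) (H : X 0 →ₗ.[ℂ] X 0) : Prop where
  selfAdjoint : IsSelfAdjoint H
  real : ∀ f : H.domain, ∃ hf : C.conj 0 f ∈ H.domain, H ⟨C.conj 0 f, hf⟩ = C.conj 0 (H f)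

/-- (H2): `lam₀` is an eigenvalue of `H` of finite multiplicity, embedded in the continuous
spectrum, isolated in the set of eigenvalues, and with eigenvectors in every `X s`, `s ≥ 0`. -/
structure H2 (H : X 0 →ₗ.[ℂ] X 0) (lam₀ : ℝ) : Prop where
  eigenvalue : IsEigenvalueOf H lam₀
  finite : FiniteDimensional ℂ (eigenspaceOf H lam₀)
  embedded : (lam₀ : ℂ) ∈ continuousSpectrumOf H
  isolated : ∃ r : ℝ, 0 < r ∧ ∀ z : ℂ, IsEigenvalueOf H z → ‖z - lam₀‖ < r → z = lam₀
  regular : ∀ φ ∈ eigenspaceOf H lam₀, ∀ (s : ℝ) (hs : 0 ≤ s), φ ∈ Set.range (S.emb hs)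

/-- The norm limits of `(A - lam ∓ i ε)⁻¹` as `ε ↓ 0` exist in `L(X s, X (-s))` for all real `lam`
in the open set `U`, and are of class `C^k` in `lam`. -/
def LimitingAbsorption {s : ℝ} (hs : 0 ≤ s) (A : X 0 →ₗ.[ℂ] X 0) (k : ℕ) (U : Set ℝ) : Prop :=
  ∃ Bplus Bminus : ℝ → (X s →L[ℂ] X (-s)),
    ContDiffOn ℝ k Bplus U ∧ ContDiffOn ℝ k Bminus U ∧
    ∀ lam ∈ U,
      Tendsto (fun ε : ℝ => S.scaleResolvent hs A (lam + ε * Complex.I)) (𝓝[>] 0)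
        (𝓝 (Bplus lam)) ∧
      Tendsto (fun ε : ℝ => S.scaleResolvent hs A (lam - ε * Complex.I)) (𝓝[>] 0)
        (𝓝 (Bminus lam))

/-- (H3)_k for `H + P₀`, with the threshold `s₁ ≥ 0` and, for every `s > s₁`, the radius
`δ₁ s > 0`. -/
structure H3 (H : X 0 →ₗ.[ℂ] X 0) (lam₀ : ℝ) (k : ℕ) (s₁ : ℝ) (δ₁ : ℝ → ℝ) : Prop where
  nonneg : 0 ≤ s₁
  pos : ∀ s : ℝ, s₁ < s → 0 < δ₁ s
  limit : ∀ (s : ℝ) (hs : 0 ≤ s), s₁ < s →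
    S.LimitingAbsorption hs (shifted H lam₀) k (Ioo (lam₀ - δ₁ s) (lam₀ + δ₁ s))

/-- `W ∈ L(X (-s), X s)` is real and self-adjoint as an operator in `X 0`. -/
structure IsPerturbation (C : S.Conjugation) {s : ℝ} (hs : 0 ≤ s) (W : X (-s) →L[ℂ] X s) :
    Prop where
  selfAdjoint : IsSelfAdjoint (S.toOp hs W)
  real : ∀ f : X 0, S.toOp hs W (C.conj 0 f) = C.conj 0 (S.toOp hs W f)

/-- Along the path `ε ↦ lam + σ i ε`, `ε ↓ 0`, the resolvent of `A` and its `lam`-derivatives up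
to order `k` converge in `L(X s, X (-s))`, uniformly in `lam ∈ J`, to a boundary value and its
derivatives of the same order. -/
def UniformLimits {s : ℝ} (hs : 0 ≤ s) (A : X 0 →ₗ.[ℂ] X 0) (k : ℕ) (J : Set ℝ) (σ : ℝ) : Prop :=
  ∃ D : ℕ → ℝ → (X s →L[ℂ] X (-s)),
    (∀ j ≤ k, TendstoUniformlyOn
      (fun (ε : ℝ) (lam : ℝ) =>
        iteratedDeriv j (fun t : ℝ => S.scaleResolvent hs A (t + σ * ε * Complex.I)) lam)
      (D j) (𝓝[>] 0) J) ∧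
    ∀ j < k, ∀ lam ∈ J, HasDerivWithinAt (D j) (D (j + 1) lam) J lam

/-- `γ > 0` is a smallness threshold for the perturbations `W` on the set `J`: if `‖W‖ < γ` in
`L(X (-s), X s)`, then the resolvent of `H + P₀ + W` and its `lam`-derivatives up to order `k`
have boundary values from above and from below, uniformly on `J`. -/
def IsThreshold (C : S.Conjugation) {s : ℝ} (hs : 0 ≤ s) (H : X 0 →ₗ.[ℂ] X 0) (lam₀ : ℝ) (k : ℕ)
    (J : Set ℝ) (γ : ℝ) : Prop :=
  0 < γ ∧ ∀ W : X (-s) →L[ℂ] X s, S.IsPerturbation C hs W → ‖W‖ < γ →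
    S.UniformLimits hs (addBounded (shifted H lam₀) (S.toOp hs W)) k J 1 ∧
    S.UniformLimits hs (addBounded (shifted H lam₀) (S.toOp hs W)) k J (-1)

/-- `Q(z, W) = P₀ (H + P₀ + W - z)⁻¹ P₀`. -/
def Qop {s : ℝ} (hs : 0 ≤ s) (H : X 0 →ₗ.[ℂ] X 0) (lam₀ : ℝ) (W : X (-s) →L[ℂ] X s) (z : ℂ) :
    X 0 →L[ℂ] X 0 :=
  (eigenprojection H lam₀).comp
    ((resolventOf (addBounded (shifted H lam₀) (S.toOp hs W)) z).comp (eigenprojection H lam₀))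

/-- `Q = P₀ B P₀` for `B ∈ L(X s, X (-s))`, where `P₀` is the orthogonal projection onto the
eigenspace of `H` at `lam₀`, whose elements lie in `X s`: the operator `Q` in `X 0` acts in the
eigenspace and vanishes on its orthogonal complement, and its matrix elements between
eigenvectors are those of `B` for the duality pairing. -/
def IsCompression {s : ℝ} (hs : 0 ≤ s) (H : X 0 →ₗ.[ℂ] X 0) (lam₀ : ℝ)
    (B : X s →L[ℂ] X (-s)) (Q : X 0 →L[ℂ] X 0) : Prop :=
  (eigenprojection H lam₀).comp (Q.comp (eigenprojection H lam₀)) = Q ∧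
    ∀ f g : X s, S.emb hs f ∈ eigenspaceOf H lam₀ → S.emb hs g ∈ eigenspaceOf H lam₀ →
      inner ℂ (Q (S.emb hs g)) (S.emb hs f) = S.pairing s (B g) f

end HilbertScale

end Scale

end

/-!
Put `A = H + P₀ + W` and `R(z) = (A - z)⁻¹`. The proof has two independent parts.

**Existence of a threshold.** For small `W` the formula `R = (1 + R₀ W)⁻¹ R₀` in
`L(X s, X (-s))`, with `R₀ = (H + P₀ - z)⁻¹`, shows that `R` inherits from `R₀` pointwise boundary
values of class `C¹` (`HilbertScale.exists_limitingAbsorption_addBounded`). What remains is that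
pointwise limits of class `C¹` are attained uniformly on compact sets together with the first
derivative (`HilbertScale.uniformLimits_of_limitingAbsorption`). For a *bounded* holomorphic
function this follows from Cauchy's formula on rectangles whose bottom side tends to the real axis,
with the kernels `1 / (w - z) - 1 / (w - z̄)` and `1 / (w - z)² - 1 / (w - z̄)²`, which are small on
the other three sides (`norm_le_of_boundary_le`, `norm_deriv_le_of_boundary_le`). No bound on the
resolvent near the real axis is given in advance; it comes from positivity. The functions
`g(z) = ⟨f, R(z) f⟩` have non-negative imaginary part in the upper half-plane, so `1 / (g + i)` is
bounded by `1` and hence uniformly close to its boundary values, which are bounded away from zero;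
therefore `g` is bounded, uniformly for `f` in the unit ball (`exists_bound_of_im_nonneg`), and `R`
is bounded by polarization.

**The eigenvalue criterion.** All matrix elements of `Q` are limits of those of `P₀ R P₀`
(`HilbertScale.Qop_eq`). If `(H + W) x = lam x`, then `(A - lam) x = P₀ x`, and
`x = R(lam + i ε) P₀ x - i ε R(lam + i ε) x`. The last term tends to zero weakly against `X s`,
because `ε ‖R f‖² = Im ⟨f, R f⟩` has a limit for `f ∈ X s`
(`HilbertScale.tendsto_inner_resolventOf`); so `P₀ x = Q P₀ x`, and `P₀ x = 0` would force `x = 0`.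
Conversely let `Q ψ = ψ ≠ 0`. Then `Im ⟨ψ, R(lam + i ε) ψ⟩ = ε ‖R(lam + i ε) ψ‖²` tends to
`Im ‖ψ‖² = 0` as `ε → 0` and has bounded derivative in `ε`, since the `lam`-derivative of the
resolvent converges. Hence `R(lam + i ε) ψ` stays bounded in `X 0`
(`HilbertScale.exists_norm_resolventOf_le`), and its weak limit `u` satisfies `(A - lam) u = ψ` and
`P₀ u = Q ψ = ψ`, that is `(H + W) u = lam u` (`HilbertScale.exists_weak_limit`).
-/

/-! ### Cauchy's formula on a rectangle -/

section Rectangle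

variable {E : Type*} [NormedAddCommGroup E] [NormedSpace ℂ E]

/-- The integral of `f` over the positively oriented boundary of the rectangle
`[-r, r] × [η, r]`. -/
noncomputable def rectIntegral (f : ℂ → E) (r η : ℝ) : E :=
  (∫ t in (-r)..r, f (t + η * Complex.I)) - (∫ t in (-r)..r, f (t + r * Complex.I)) +
    Complex.I • (∫ y in η..r, f (r + y * Complex.I)) -
      Complex.I • (∫ y in η..r, f ((-r : ℝ) + y * Complex.I))

/-- The open upper half-plane without the point `i ε`. -/
def puncturedUpper (ε : ℝ) : Set ℂ := {w | 0 < w.im ∧ w ≠ ε * Complex.I}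

theorem intervalIntegral_nonpos {f : ℝ → ℝ} {a b : ℝ} (hab : a ≤ b)
    (hf : ∀ t ∈ Icc a b, f t ≤ 0) : ∫ t in a..b, f t ≤ 0 := by
  have := intervalIntegral.integral_nonneg (f := fun t => -f t) (μ := MeasureTheory.volume) hab
    fun t ht => neg_nonneg.2 (hf t ht)
  rw [intervalIntegral.integral_neg] at this
  linarith

section sides

variable {r η ε : ℝ} (h0 : 0 < η) (h1 : η < ε) (h2 : ε < r)

include h0 h1 in
theorem bottom_mem (t : ℝ) : (t + η * Complex.I : ℂ) ∈ puncturedUpper ε := by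
  refine ⟨by simpa using h0, fun h => ?_⟩
  have := congrArg Complex.im h
  simp at this
  linarith

include h0 h1 h2 in
theorem top_mem (t : ℝ) : (t + r * Complex.I : ℂ) ∈ puncturedUpper ε := by
  refine ⟨by simpa using by linarith, fun h => ?_⟩
  have := congrArg Complex.im h
  simp at this
  linarith

include h0 in
theorem vertical_mem {x : ℝ} (hx : x ≠ 0) {y : ℝ} (hy : η ≤ y) :
    (x + y * Complex.I : ℂ) ∈ puncturedUpper ε := by
  refine ⟨by simpa using by linarith, fun h => ?_⟩
  have := congrArg Complex.re h
  simp at this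
  exact hx this

include h0 h1 h2

omit [NormedSpace ℂ E] h2 in
theorem bottom_intervalIntegrable {f : ℂ → E} (hf : ContinuousOn f (puncturedUpper ε)) (a b : ℝ) :
    IntervalIntegrable (fun t : ℝ => f (t + η * Complex.I)) MeasureTheory.volume a b :=
  (hf.comp_continuous (by fun_prop) (bottom_mem h0 h1)).intervalIntegrable _ _

omit [NormedSpace ℂ E] in
theorem top_intervalIntegrable {f : ℂ → E} (hf : ContinuousOn f (puncturedUpper ε)) (a b : ℝ) :
    IntervalIntegrable (fun t : ℝ => f (t + r * Complex.I)) MeasureTheory.volume a b :=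
  (hf.comp_continuous (by fun_prop) (top_mem h0 h1 h2)).intervalIntegrable _ _

omit [NormedSpace ℂ E] in
theorem vertical_intervalIntegrable {f : ℂ → E} (hf : ContinuousOn f (puncturedUpper ε)) {x : ℝ}
    (hx : x ≠ 0) :
    IntervalIntegrable (fun y : ℝ => f (x + y * Complex.I)) MeasureTheory.volume η r := by
  refine ContinuousOn.intervalIntegrable ?_
  refine hf.comp (by fun_prop) fun y hy => ?_
  rw [uIcc_of_le (by linarith)] at hy
  exact vertical_mem h0 hx hy.1

theorem rectIntegral_add {f g : ℂ → E} (hf : ContinuousOn f (puncturedUpper ε))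
    (hg : ContinuousOn g (puncturedUpper ε)) :
    rectIntegral (fun w => f w + g w) r η = rectIntegral f r η + rectIntegral g r η := by
  have hr : r ≠ 0 := by linarith
  have hr' : -r ≠ 0 := by linarith
  unfold rectIntegral
  rw [intervalIntegral.integral_add (bottom_intervalIntegrable h0 h1 hf _ _)
      (bottom_intervalIntegrable h0 h1 hg _ _),
    intervalIntegral.integral_add (top_intervalIntegrable h0 h1 h2 hf _ _)
      (top_intervalIntegrable h0 h1 h2 hg _ _),
    intervalIntegral.integral_add (vertical_intervalIntegrable h0 h1 h2 hf hr)
      (vertical_intervalIntegrable h0 h1 h2 hg hr),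
    intervalIntegral.integral_add (vertical_intervalIntegrable h0 h1 h2 hf hr')
      (vertical_intervalIntegrable h0 h1 h2 hg hr')]
  simp only [smul_add]
  abel

theorem rectIntegral_congr {f g : ℂ → E} (h : EqOn f g (puncturedUpper ε)) :
    rectIntegral f r η = rectIntegral g r η := by
  have hr : r ≠ 0 := by linarith
  have hr' : -r ≠ 0 := by linarith
  have key : ∀ x : ℝ, x ≠ 0 → (∫ y in η..r, f (x + y * Complex.I))
      = ∫ y in η..r, g (x + y * Complex.I) := fun x hx =>
    intervalIntegral.integral_congr fun y hy => by
      rw [uIcc_of_le (by linarith)] at hy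
      exact h (vertical_mem h0 hx hy.1)
  unfold rectIntegral
  rw [key r hr, key (-r) hr',
    intervalIntegral.integral_congr fun t _ => h (bottom_mem h0 h1 t),
    intervalIntegral.integral_congr fun t _ => h (top_mem h0 h1 h2 t)]

omit h0 h1 h2 in
theorem rectIntegral_smul_const [CompleteSpace E] (φ : ℂ → ℂ) (v : E) :
    rectIntegral (fun w => φ w • v) r η = rectIntegral φ r η • v := by
  unfold rectIntegral
  simp only [intervalIntegral.integral_smul_const, sub_smul, add_smul, smul_assoc]

theorem rectIntegral_eq_zero [CompleteSpace E] {f : ℂ → E}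
    (hf : DifferentiableOn ℂ f {w | 0 < w.im}) : rectIntegral f r η = 0 := by
  have := Complex.integral_boundary_rect_eq_zero_of_differentiableOn f
    ⟨-r, η⟩ ⟨r, r⟩ (hf.mono ?_)
  · simpa [rectIntegral] using this
  · intro w hw
    have := (Complex.mem_reProdIm.1 hw).2
    simp only at this
    rw [uIcc_of_le (by linarith)] at this
    exact h0.trans_le this.1

theorem rectIntegral_inv_sq :
    rectIntegral (fun w : ℂ => ((w - ε * Complex.I) ^ 2)⁻¹) r η = 0 := by
  have hr : r ≠ 0 := by linarith
  have hr' : -r ≠ 0 := by linarith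
  have hc : ContinuousOn (fun w : ℂ => ((w - ε * Complex.I) ^ 2)⁻¹) (puncturedUpper ε) := by
    refine ContinuousOn.inv₀ (by fun_prop) fun w hw => ?_
    exact pow_ne_zero _ (sub_ne_zero.2 hw.2)
  have hd : ∀ w ∈ puncturedUpper ε, HasDerivAt (fun w : ℂ => -(w - ε * Complex.I)⁻¹)
      (((w - ε * Complex.I) ^ 2)⁻¹) w := fun w hw => by
    have h := (((hasDerivAt_id w).sub_const (ε * Complex.I : ℂ)).inv (sub_ne_zero.2 hw.2)).neg
    simp only [id, neg_div, neg_neg, one_div] at h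
    exact h
  have hhor : ∀ y : ℝ, (∀ t : ℝ, (t + y * Complex.I : ℂ) ∈ puncturedUpper ε) →
      ∫ t in (-r)..r, ((t + y * Complex.I - ε * Complex.I : ℂ) ^ 2)⁻¹
      = -((r : ℝ) + y * Complex.I - ε * Complex.I : ℂ)⁻¹
        - -((-r : ℝ) + y * Complex.I - ε * Complex.I : ℂ)⁻¹ := fun y hy => by
    refine intervalIntegral.integral_eq_sub_of_hasDerivAt
      (f := fun t : ℝ => -(t + y * Complex.I - ε * Complex.I : ℂ)⁻¹) (fun t _ => ?_)
      (hc.comp_continuous (f := fun t : ℝ => (t + y * Complex.I : ℂ))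
        (by fun_prop) hy).continuousOn.intervalIntegrable
    have h := (hd _ (hy t)).comp t
      ((Complex.ofRealCLM.hasDerivAt (x := t)).add_const (y * Complex.I : ℂ))
    simpa [Function.comp_def] using h
  have hver : ∀ x : ℝ, x ≠ 0 →
      Complex.I • ∫ y in η..r, ((x + y * Complex.I - ε * Complex.I : ℂ) ^ 2)⁻¹
      = -(x + r * Complex.I - ε * Complex.I : ℂ)⁻¹
        - -(x + η * Complex.I - ε * Complex.I : ℂ)⁻¹ := fun x hx => by
    rw [← intervalIntegral.integral_smul]
    refine intervalIntegral.integral_eq_sub_of_hasDerivAt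
      (f := fun y : ℝ => -(x + y * Complex.I - ε * Complex.I : ℂ)⁻¹) (fun y hy => ?_)
      ((vertical_intervalIntegrable h0 h1 h2 hc hx).smul Complex.I)
    rw [uIcc_of_le (by linarith)] at hy
    have h := (hd _ (vertical_mem h0 hx hy.1)).comp y
      (((Complex.ofRealCLM.hasDerivAt (x := y)).mul_const Complex.I).const_add (x : ℂ))
    simpa [Function.comp_def, mul_comm] using h
  unfold rectIntegral
  rw [hhor η (bottom_mem h0 h1), hhor r (top_mem h0 h1 h2), hver r hr, hver (-r) hr']
  ring

/-- A lower bound for `2 π` times the winding number of the boundary of the rectangle around `i ε`,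
which is all that the estimates below need: each side contributes a non-negative imaginary part,
and the bottom side at least `1`. -/
theorem one_le_norm_rectIntegral_inv :
    1 ≤ ‖rectIntegral (fun w : ℂ => (w - ε * Complex.I)⁻¹) r η‖ := by
  have hr : r ≠ 0 := by linarith
  have hr' : -r ≠ 0 := by linarith
  have hc : ContinuousOn (fun w : ℂ => (w - ε * Complex.I)⁻¹) (puncturedUpper ε) :=
    ContinuousOn.inv₀ (by fun_prop) fun w hw => sub_ne_zero.2 hw.2
  have him : ∀ {f : ℝ → ℂ} {a b : ℝ}, IntervalIntegrable f MeasureTheory.volume a b →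
      (∫ t in a..b, f t).im = ∫ t in a..b, (f t).im := fun hf =>
    (Complex.imCLM.intervalIntegral_comp_comm hf).symm
  have hre : ∀ {f : ℝ → ℂ} {a b : ℝ}, IntervalIntegrable f MeasureTheory.volume a b →
      (∫ t in a..b, f t).re = ∫ t in a..b, (f t).re := fun hf =>
    (Complex.reCLM.intervalIntegral_comp_comm hf).symm
  have hb : 1 ≤ ∫ t in (-r)..r, ((t + η * Complex.I - ε * Complex.I : ℂ)⁻¹).im := by
    set δ := ε - η with hδ
    have hδ0 : 0 < δ := by linarith
    have e : ∀ t : ℝ, ((t + η * Complex.I - ε * Complex.I : ℂ)⁻¹).im = δ / (t ^ 2 + δ ^ 2) := by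
      intro t
      simp [Complex.inv_im, Complex.normSq_apply]
      rw [hδ]; ring_nf
    simp_rw [e]
    have hcont : Continuous fun t : ℝ => δ / (t ^ 2 + δ ^ 2) :=
      continuous_const.div (by fun_prop) fun t => by positivity
    calc (1 : ℝ) = ∫ t in (-δ)..δ, 1 / (2 * δ) := by
          rw [intervalIntegral.integral_const, smul_eq_mul]; field_simp; ring
      _ ≤ ∫ t in (-δ)..δ, δ / (t ^ 2 + δ ^ 2) := by
          refine intervalIntegral.integral_mono_on (by linarith) (by simp)
            (hcont.intervalIntegrable _ _) fun t ht => ?_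
          rw [div_le_div_iff₀ (by positivity) (by positivity)]
          nlinarith [ht.1, ht.2]
      _ ≤ ∫ t in (-r)..r, δ / (t ^ 2 + δ ^ 2) := by
          refine intervalIntegral.integral_mono_interval (by linarith) (by linarith) (by linarith)
            (Eventually.of_forall fun t => ?_) (hcont.intervalIntegrable _ _)
          simp only [Pi.zero_apply]; positivity
  have ht : ∫ t in (-r)..r, ((t + r * Complex.I - ε * Complex.I : ℂ)⁻¹).im ≤ 0 := by
    refine intervalIntegral_nonpos (by linarith) fun t _ => ?_
    rw [Complex.inv_im]
    refine div_nonpos_of_nonpos_of_nonneg ?_ (Complex.normSq_nonneg _)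
    simp; linarith
  have hR : 0 ≤ ∫ y in η..r, ((r + y * Complex.I - ε * Complex.I : ℂ)⁻¹).re := by
    refine intervalIntegral.integral_nonneg (by linarith) fun t _ => ?_
    rw [Complex.inv_re]
    refine div_nonneg ?_ (Complex.normSq_nonneg _)
    simp; linarith
  have hL : ∫ y in η..r, (((-r : ℝ) + y * Complex.I - ε * Complex.I : ℂ)⁻¹).re ≤ 0 := by
    refine intervalIntegral_nonpos (by linarith) fun t _ => ?_
    rw [Complex.inv_re]
    refine div_nonpos_of_nonpos_of_nonneg ?_ (Complex.normSq_nonneg _)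
    simp; linarith
  refine le_trans ?_ (Complex.abs_im_le_norm _)
  refine le_trans ?_ (le_abs_self _)
  unfold rectIntegral
  have I_im : ∀ z : ℂ, (Complex.I • z).im = z.re := fun z => by simp
  rw [Complex.sub_im, Complex.add_im, Complex.sub_im, I_im, I_im,
    him (bottom_intervalIntegrable h0 h1 hc _ _), him (top_intervalIntegrable h0 h1 h2 hc _ _),
    hre (vertical_intervalIntegrable h0 h1 h2 hc hr),
    hre (vertical_intervalIntegrable h0 h1 h2 hc hr')]
  linarith

variable [CompleteSpace E] {q : ℂ → E} (hq : DifferentiableOn ℂ q {w | 0 < w.im})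
include hq

/-- Cauchy's formula for `q (i ε)`, with the winding number left as an integral. -/
theorem rectIntegral_inv_smul :
    rectIntegral (fun w => (w - ε * Complex.I)⁻¹ • q w) r η
      = rectIntegral (fun w : ℂ => (w - ε * Complex.I)⁻¹) r η • q (ε * Complex.I) := by
  have hU : {w : ℂ | 0 < w.im} ∈ 𝓝 (ε * Complex.I : ℂ) :=
    (isOpen_lt continuous_const Complex.continuous_im).mem_nhds (by simpa using h0.trans h1)
  have hD := (Complex.differentiableOn_dslope hU).2 hq
  have hsub : puncturedUpper ε ⊆ {w : ℂ | 0 < w.im} := fun w hw => hw.1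
  have hc : ContinuousOn (fun w : ℂ => (w - ε * Complex.I)⁻¹) (puncturedUpper ε) :=
    ContinuousOn.inv₀ (by fun_prop) fun w hw => sub_ne_zero.2 hw.2
  rw [rectIntegral_congr h0 h1 h2 (g := fun w => dslope q (ε * Complex.I) w
      + (w - ε * Complex.I)⁻¹ • q (ε * Complex.I)), rectIntegral_add h0 h1 h2
      (g := fun w => (w - ε * Complex.I)⁻¹ • q (ε * Complex.I))
      (hD.continuousOn.mono hsub) (hc.smul continuousOn_const), rectIntegral_smul_const,
      rectIntegral_eq_zero h0 h1 h2 hD, zero_add]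
  intro w hw
  simp only
  rw [dslope_of_ne _ hw.2, slope_def_module, ← smul_add, sub_add_cancel]

/-- Cauchy's formula for `q' (i ε)`, with the winding number left as an integral. -/
theorem rectIntegral_inv_sq_smul :
    rectIntegral (fun w => ((w - ε * Complex.I) ^ 2)⁻¹ • q w) r η
      = rectIntegral (fun w : ℂ => (w - ε * Complex.I)⁻¹) r η • deriv q (ε * Complex.I) := by
  have hU : {w : ℂ | 0 < w.im} ∈ 𝓝 (ε * Complex.I : ℂ) :=
    (isOpen_lt continuous_const Complex.continuous_im).mem_nhds (by simpa using h0.trans h1)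
  have hD := (Complex.differentiableOn_dslope hU).2 hq
  have hsub : puncturedUpper ε ⊆ {w : ℂ | 0 < w.im} := fun w hw => hw.1
  have hc : ContinuousOn (fun w : ℂ => (w - ε * Complex.I)⁻¹) (puncturedUpper ε) :=
    ContinuousOn.inv₀ (by fun_prop) fun w hw => sub_ne_zero.2 hw.2
  have hc2 : ContinuousOn (fun w : ℂ => ((w - ε * Complex.I) ^ 2)⁻¹) (puncturedUpper ε) :=
    ContinuousOn.inv₀ (by fun_prop) fun w hw => pow_ne_zero _ (sub_ne_zero.2 hw.2)
  rw [rectIntegral_congr h0 h1 h2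
      (g := fun w => (w - ε * Complex.I)⁻¹ • dslope q (ε * Complex.I) w
      + ((w - ε * Complex.I) ^ 2)⁻¹ • q (ε * Complex.I)), rectIntegral_add h0 h1 h2
      (f := fun w => (w - ε * Complex.I)⁻¹ • dslope q (ε * Complex.I) w)
      (g := fun w => ((w - ε * Complex.I) ^ 2)⁻¹ • q (ε * Complex.I))
      (hc.smul (hD.continuousOn.mono hsub)) (hc2.smul continuousOn_const),
      rectIntegral_smul_const, rectIntegral_inv_sq h0 h1 h2, rectIntegral_inv_smul h0 h1 h2 hD,
      zero_smul, add_zero, dslope_same]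
  intro w hw
  simp only
  rw [dslope_of_ne _ hw.2, slope_def_module, smul_smul, ← sq, ← inv_pow, ← smul_add,
    sub_add_cancel]

end sides

end Rectangle

/-! ### Poisson-type estimates near the boundary of the half-plane -/

section Poisson

variable {E : Type*} [NormedAddCommGroup E] [NormedSpace ℂ E]

theorem integral_poisson_le {ε : ℝ} (hε : 0 < ε) (r : ℝ) :
    ∫ t in (-r)..r, ε / (t ^ 2 + ε ^ 2) ≤ Real.pi := by
  have hd : ∀ t : ℝ, HasDerivAt (fun t => Real.arctan (t / ε)) (ε / (t ^ 2 + ε ^ 2)) t := by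
    intro t
    have h := ((hasDerivAt_id t).div_const ε).arctan
    simp only [id] at h
    convert h using 1
    field_simp
    ring
  have hc : Continuous fun t : ℝ => ε / (t ^ 2 + ε ^ 2) :=
    continuous_const.div (by fun_prop) fun t => by positivity
  rw [intervalIntegral.integral_eq_sub_of_hasDerivAt (fun t _ => hd t)
    (hc.intervalIntegrable _ _)]
  have := Real.arctan_lt_pi_div_two (r / ε)
  have := Real.neg_pi_div_two_lt_arctan (-r / ε)
  linarith

/-- If Cauchy's formula with kernel `k` on the rectangles `[-r, r] × [η, r]` reproduces `v`, then
letting `η → 0` bounds `v` by the boundary values `b` on `[-r, r]`, up to the contribution of the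
other three sides, where `k` is small. -/
theorem norm_le_of_rectIntegral_eq {G : ℂ → E} {b : ℝ → E} {k : ℂ → ℂ} {v : E}
    {r ε κ M K β : ℝ} (hε : 0 < ε) (hr : 2 * ε ≤ r)
    (hG : ContinuousOn G {w | 0 < w.im})
    (hM : ∀ w : ℂ, |w.re| ≤ r → 0 < w.im → w.im ≤ r → ‖G w‖ ≤ M)
    (hb : ∀ t : ℝ, |t| ≤ r →
      Tendsto (fun η : ℝ => G (t + η * Complex.I)) (𝓝[>] 0) (𝓝 (b t)))
    (hk : ContinuousOn k (puncturedUpper ε))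
    (hK : ∀ t η : ℝ, |t| ≤ r → 0 < η → η ≤ ε / 2 → ‖k (t + η * Complex.I)‖ ≤ K)
    (hk0 : ∀ t : ℝ, Tendsto (fun η : ℝ => k (t + η * Complex.I)) (𝓝[>] 0) (𝓝 (k t)))
    (hβ : ∀ w : ℂ, |w.re| ≤ r → 0 < w.im → w.im ≤ r → r ≤ ‖w‖ → ‖k w‖ ≤ β)
    (hκ : ∀ t : ℝ, |t| ≤ r → ‖k t‖ * ‖b t‖ ≤ κ * (ε / (t ^ 2 + ε ^ 2)))
    (hv : ∀ η : ℝ, 0 < η → η ≤ ε / 2 →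
      ∃ c : ℂ, 1 ≤ ‖c‖ ∧ rectIntegral (fun w => k w • G w) r η = c • v) :
    ‖v‖ ≤ Real.pi * κ + 4 * r * (β * M) := by
  have hr0 : 0 < r := by linarith
  have hsub : puncturedUpper ε ⊆ {w : ℂ | 0 < w.im} := fun w hw => hw.1
  have hf : ContinuousOn (fun w => k w • G w) (puncturedUpper ε) := hk.smul (hG.mono hsub)
  have hM0 : 0 ≤ M := (norm_nonneg _).trans
    (hM (r * Complex.I) (by simpa using hr0.le) (by simpa using hr0) (by simp))
  have hβ0 : 0 ≤ β := (norm_nonneg _).trans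
    (hβ (r * Complex.I) (by simpa using hr0.le) (by simpa using hr0) (by simp)
      (by simp [abs_of_pos hr0]))
  have hK0 : 0 ≤ K := (norm_nonneg _).trans
    (hK 0 (ε / 2) (by simpa using hr0.le) (by positivity) le_rfl)
  have hsmall : ∀ᶠ η : ℝ in 𝓝[>] 0, 0 < η ∧ η ≤ ε / 2 := by
    filter_upwards [Ioc_mem_nhdsGT (show (0 : ℝ) < ε / 2 by positivity)] with η hη using hη
  have hside : ∀ w : ℂ, |w.re| ≤ r → 0 < w.im → w.im ≤ r → r ≤ ‖w‖ → ‖k w • G w‖ ≤ β * M :=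
    fun w h1 h2 h3 h4 => by
      rw [norm_smul]
      exact mul_le_mul (hβ w h1 h2 h3 h4) (hM w h1 h2 h3) (norm_nonneg _) hβ0
  have hlim : Tendsto (fun η : ℝ => ∫ t in (-r)..r, k (t + η * Complex.I) • G (t + η * Complex.I))
      (𝓝[>] 0) (𝓝 (∫ t in (-r)..r, k t • b t)) := by
    refine intervalIntegral.tendsto_integral_filter_of_dominated_convergence (fun _ => K * M)
      ?_ ?_ (by simp) ?_
    · filter_upwards [hsmall] with η hη
      exact (hf.comp_continuous (f := fun t : ℝ => (t + η * Complex.I : ℂ)) (by fun_prop)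
        (bottom_mem hη.1 (by linarith [hη.2]))).aestronglyMeasurable
    · filter_upwards [hsmall] with η hη
      refine Eventually.of_forall fun t ht => ?_
      rw [uIoc_of_le (by linarith)] at ht
      have ht' : |t| ≤ r := abs_le.2 ⟨ht.1.le, ht.2⟩
      rw [norm_smul]
      exact mul_le_mul (hK t η ht' hη.1 hη.2)
        (hM _ (by simpa using ht') (by simpa using hη.1) (by simpa using by linarith [hη.2]))
        (norm_nonneg _) hK0
    · refine Eventually.of_forall fun t ht => ?_
      rw [uIoc_of_le (by linarith)] at ht
      exact (hk0 t).smul (hb t (abs_le.2 ⟨ht.1.le, ht.2⟩))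
  have hbot : ‖∫ t in (-r)..r, k t • b t‖ ≤ Real.pi * κ := by
    have hc : Continuous fun t : ℝ => κ * (ε / (t ^ 2 + ε ^ 2)) :=
      continuous_const.mul (continuous_const.div (by fun_prop) fun t => by positivity)
    have hκ0 : 0 ≤ κ := by
      have h := (mul_nonneg (norm_nonneg _) (norm_nonneg _)).trans (hκ 0 (by simpa using hr0.le))
      exact nonneg_of_mul_nonneg_left h (by positivity)
    refine (intervalIntegral.norm_integral_le_of_norm_le (g := fun t => κ * (ε / (t ^ 2 + ε ^ 2)))
      (by linarith) ?_ (hc.intervalIntegrable _ _)).trans ?_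
    · refine Eventually.of_forall fun t ht => ?_
      rw [norm_smul]
      exact hκ t (abs_le.2 ⟨ht.1.le, ht.2⟩)
    · rw [intervalIntegral.integral_const_mul, mul_comm]
      exact mul_le_mul_of_nonneg_right (integral_poisson_le hε r) hκ0
  have hev : ∀ᶠ η : ℝ in 𝓝[>] 0,
      ‖v‖ ≤ ‖∫ t in (-r)..r, k (t + η * Complex.I) • G (t + η * Complex.I)‖ + 4 * r * (β * M) := by
    filter_upwards [hsmall] with η hη
    obtain ⟨c, hc, hcv⟩ := hv η hη.1 hη.2
    have h1 : ‖v‖ ≤ ‖c • v‖ := by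
      rw [norm_smul]; exact le_mul_of_one_le_left (norm_nonneg _) hc
    have ht : ‖∫ t in (-r)..r, k (t + r * Complex.I) • G (t + r * Complex.I)‖
        ≤ β * M * |r - (-r)| := by
      refine intervalIntegral.norm_integral_le_of_norm_le_const fun t ht => ?_
      rw [uIoc_of_le (by linarith)] at ht
      refine hside _ (by simpa using abs_le.2 ⟨ht.1.le, ht.2⟩) (by simpa using hr0) (by simp) ?_
      refine le_trans ?_ (Complex.abs_im_le_norm _)
      simp [abs_of_pos hr0]
    have hlr : ∀ x : ℝ, |x| = r →
        ‖∫ y in η..r, k (x + y * Complex.I) • G (x + y * Complex.I)‖ ≤ β * M * |r - η| := by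
      intro x hx
      refine intervalIntegral.norm_integral_le_of_norm_le_const fun y hy => ?_
      rw [uIoc_of_le (by linarith [hη.2])] at hy
      refine hside _ (by simp [hx]) (by simpa using hη.1.trans hy.1) (by simpa using hy.2) ?_
      refine le_trans ?_ (Complex.abs_re_le_norm _)
      simp [hx]
    have hηr : |r - η| ≤ r := by
      rw [abs_of_nonneg (by linarith [hη.2])]; linarith [hη.1]
    have e1 := (hlr r (abs_of_pos hr0)).trans
      (mul_le_mul_of_nonneg_left hηr (mul_nonneg hβ0 hM0))
    have e2 := (hlr (-r) (by rw [abs_neg, abs_of_pos hr0])).trans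
      (mul_le_mul_of_nonneg_left hηr (mul_nonneg hβ0 hM0))
    rw [abs_of_nonneg (by linarith)] at ht
    rw [← hcv] at h1
    refine h1.trans ?_
    unfold rectIntegral
    refine (norm_sub_le _ _).trans ?_
    have := norm_add_le ((∫ t in (-r)..r, k (t + η * Complex.I) • G (t + η * Complex.I))
      - ∫ t in (-r)..r, k (t + r * Complex.I) • G (t + r * Complex.I))
      (Complex.I • ∫ y in η..r, k (r + y * Complex.I) • G (r + y * Complex.I))
    have := norm_sub_le (∫ t in (-r)..r, k (t + η * Complex.I) • G (t + η * Complex.I))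
      (∫ t in (-r)..r, k (t + r * Complex.I) • G (t + r * Complex.I))
    rw [norm_smul, Complex.norm_I, one_mul] at *
    linarith
  have := le_of_tendsto_of_tendsto tendsto_const_nhds
    (hlim.norm.add_const (4 * r * (β * M))) hev
  linarith

section kernel

variable {ε : ℝ} (hε : 0 < ε)

include hε

theorem sq_add_sq_ne_zero {w : ℂ} (h0 : 0 ≤ w.im) (h : w ≠ ε * Complex.I) :
    w ^ 2 + (ε : ℂ) ^ 2 ≠ 0 := by
  have e : w ^ 2 + (ε : ℂ) ^ 2 = (w - ε * Complex.I) * (w + ε * Complex.I) := by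
    linear_combination (ε : ℂ) ^ 2 * Complex.I_sq
  rw [e]
  refine mul_ne_zero (sub_ne_zero.2 h) fun h' => ?_
  have := congrArg Complex.im h'
  simp at this
  linarith

theorem norm_sq_add_sq_ge {t η : ℝ} (h0 : 0 ≤ η) (h : η ≤ ε / 2) :
    ε ^ 2 / 2 ≤ ‖(t + η * Complex.I : ℂ) ^ 2 + (ε : ℂ) ^ 2‖ := by
  have e : (t + η * Complex.I : ℂ) ^ 2 + (ε : ℂ) ^ 2
      = (t + η * Complex.I - ε * Complex.I) * (t + η * Complex.I + ε * Complex.I) := by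
    linear_combination (ε : ℂ) ^ 2 * Complex.I_sq
  have h1 : ε / 2 ≤ ‖(t + η * Complex.I - ε * Complex.I : ℂ)‖ := by
    refine le_trans ?_ (Complex.abs_im_le_norm _)
    simp
    rw [abs_of_nonpos (by linarith)]; linarith
  have h2 : ε ≤ ‖(t + η * Complex.I + ε * Complex.I : ℂ)‖ := by
    refine le_trans ?_ (Complex.abs_im_le_norm _)
    simp
    rw [abs_of_nonneg (by linarith)]; linarith
  rw [e, norm_mul]
  calc ε ^ 2 / 2 = ε / 2 * ε := by ring
    _ ≤ _ := mul_le_mul h1 h2 hε.le (norm_nonneg _)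

theorem norm_sq_add_sq_ge_of_le_norm {r : ℝ} (hr : 2 * ε ≤ r) {w : ℂ} (hw : r ≤ ‖w‖) :
    r ^ 2 / 2 ≤ ‖w ^ 2 + (ε : ℂ) ^ 2‖ := by
  have h : ‖w ^ 2‖ - ‖(ε : ℂ) ^ 2‖ ≤ ‖w ^ 2 + (ε : ℂ) ^ 2‖ := by
    have := norm_sub_norm_le (w ^ 2) (-(ε : ℂ) ^ 2)
    rwa [sub_neg_eq_add, norm_neg] at this
  rw [norm_pow, norm_pow, Complex.norm_real, Real.norm_of_nonneg hε.le] at h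
  nlinarith

theorem norm_ofReal_sq_add_sq (t : ℝ) : ‖(t : ℂ) ^ 2 + (ε : ℂ) ^ 2‖ = t ^ 2 + ε ^ 2 := by
  have : (t : ℂ) ^ 2 + (ε : ℂ) ^ 2 = ((t ^ 2 + ε ^ 2 : ℝ) : ℂ) := by push_cast; ring
  rw [this, Complex.norm_real, Real.norm_of_nonneg (by positivity)]

end kernel

variable [CompleteSpace E] {G : ℂ → E} {b : ℝ → E} {r ε κ M : ℝ}

/-- The value at `i ε` of a bounded holomorphic function is controlled by its boundary values. -/
theorem norm_le_of_boundary_le (hε : 0 < ε) (hr : 2 * ε ≤ r)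
    (hG : DifferentiableOn ℂ G {w | 0 < w.im})
    (hM : ∀ w : ℂ, |w.re| ≤ r → 0 < w.im → w.im ≤ r → ‖G w‖ ≤ M)
    (hb : ∀ t : ℝ, |t| ≤ r →
      Tendsto (fun η : ℝ => G (t + η * Complex.I)) (𝓝[>] 0) (𝓝 (b t)))
    (hκ : ∀ t : ℝ, |t| ≤ r → ‖b t‖ ≤ κ) :
    ‖G (ε * Complex.I)‖ ≤ 2 * Real.pi * κ + 16 * M * ε / r := by
  have hr0 : 0 < r := by linarith
  have hn : ‖(2 * ε * Complex.I : ℂ)‖ = 2 * ε := by simp [abs_of_pos hε]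
  -- `k w = 1 / (w - i ε) - 1 / (w + i ε)` is the Poisson kernel on the real axis
  have key := norm_le_of_rectIntegral_eq (G := G) (b := b)
    (k := fun w => 2 * ε * Complex.I / (w ^ 2 + (ε : ℂ) ^ 2)) (v := G (ε * Complex.I))
    (κ := 2 * κ) (M := M) (K := 4 / ε) (β := 4 * ε / r ^ 2) hε hr hG.continuousOn hM hb
    (continuousOn_const.div (by fun_prop) fun w hw => sq_add_sq_ne_zero hε hw.1.le hw.2)
    ?_ ?_ ?_ ?_ ?_
  · refine key.trans (le_of_eq ?_)
    field_simp
    ring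
  · intro t η _ h1 h2
    rw [norm_div, hn, div_le_div_iff₀ ((by positivity : 0 < ε ^ 2 / 2).trans_le
      (norm_sq_add_sq_ge hε h1.le h2)) hε]
    nlinarith [norm_sq_add_sq_ge hε (t := t) h1.le h2]
  · intro t
    have h : ContinuousAt (fun η : ℝ => 2 * ε * Complex.I /
        ((t + η * Complex.I : ℂ) ^ 2 + (ε : ℂ) ^ 2)) 0 := by
      refine ContinuousAt.div continuousAt_const (by fun_prop) ?_
      have := norm_sq_add_sq_ge hε (t := t) le_rfl (by positivity)
      intro h0
      rw [h0, norm_zero] at this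
      linarith [(by positivity : 0 < ε ^ 2 / 2)]
    have := h.tendsto.mono_left (nhdsWithin_le_nhds (s := Ioi 0))
    simpa using this
  · intro w _ _ _ hw
    have h := norm_sq_add_sq_ge_of_le_norm hε hr hw
    rw [norm_div, hn, div_le_div_iff₀ ((by positivity : 0 < r ^ 2 / 2).trans_le h)
      (by positivity)]
    nlinarith
  · intro t ht
    rw [norm_div, hn, norm_ofReal_sq_add_sq hε]
    have : 0 ≤ 2 * ε / (t ^ 2 + ε ^ 2) := by positivity
    calc _ ≤ 2 * ε / (t ^ 2 + ε ^ 2) * κ := mul_le_mul_of_nonneg_left (hκ t ht) this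
      _ = _ := by ring
  · intro η h1 h2
    have h1' : η < ε := by linarith
    have h2' : ε < r := by linarith
    refine ⟨_, one_le_norm_rectIntegral_inv h1 h1' h2', ?_⟩
    have hq : DifferentiableOn ℂ (fun w => (2 * ε * Complex.I / (w + ε * Complex.I)) • G w)
        {w | 0 < w.im} := by
      refine DifferentiableOn.smul (DifferentiableOn.div (by fun_prop) (by fun_prop) ?_) hG
      intro w hw h
      have := congrArg Complex.im h
      simp at this hw
      linarith
    have h := rectIntegral_inv_smul h1 h1' h2' hq
    have e : (2 * ε * Complex.I / (ε * Complex.I + ε * Complex.I) : ℂ) = 1 := by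
      rw [← add_mul, ← two_mul, div_self]
      simp [hε.ne']
    rw [e, one_smul] at h
    rw [← h]
    refine rectIntegral_congr h1 h1' h2' fun w hw => ?_
    rw [smul_smul]
    congr 1
    have : w ^ 2 + (ε : ℂ) ^ 2 = (w - ε * Complex.I) * (w + ε * Complex.I) := by
      linear_combination (ε : ℂ) ^ 2 * Complex.I_sq
    rw [this, div_eq_mul_inv, mul_inv, div_eq_mul_inv]
    ring

/-- The derivative at `i ε` of a bounded holomorphic function is controlled by its boundary values
if these vanish to first order at `0`. -/
theorem norm_deriv_le_of_boundary_le (hε : 0 < ε) (hr : 2 * ε ≤ r)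
    (hG : DifferentiableOn ℂ G {w | 0 < w.im})
    (hM : ∀ w : ℂ, |w.re| ≤ r → 0 < w.im → w.im ≤ r → ‖G w‖ ≤ M)
    (hb : ∀ t : ℝ, |t| ≤ r →
      Tendsto (fun η : ℝ => G (t + η * Complex.I)) (𝓝[>] 0) (𝓝 (b t)))
    (hκ : ∀ t : ℝ, |t| ≤ r → ‖b t‖ ≤ κ * |t|) :
    ‖deriv G (ε * Complex.I)‖ ≤ 4 * Real.pi * κ + 128 * M * ε / r ^ 2 := by
  have hr0 : 0 < r := by linarith
  have hn : ‖(4 * ε * Complex.I : ℂ)‖ = 4 * ε := by simp [abs_of_pos hε]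
  -- `k w = 1 / (w - i ε)² - 1 / (w + i ε)²`
  have key := norm_le_of_rectIntegral_eq (G := G) (b := b)
    (k := fun w => 4 * ε * Complex.I * w / (w ^ 2 + (ε : ℂ) ^ 2) ^ 2)
    (v := deriv G (ε * Complex.I))
    (κ := 4 * κ) (M := M) (K := 4 * ε * (2 * r) / (ε ^ 2 / 2) ^ 2) (β := 32 * ε / r ^ 3)
    hε hr hG.continuousOn hM hb
    (ContinuousOn.div (by fun_prop) (by fun_prop)
      fun w hw => pow_ne_zero _ (sq_add_sq_ne_zero hε hw.1.le hw.2))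
    ?_ ?_ ?_ ?_ ?_
  · refine key.trans (le_of_eq ?_)
    field_simp
    ring
  · intro t η ht h1 h2
    have h := norm_sq_add_sq_ge hε (t := t) h1.le h2
    have hw : ‖(t + η * Complex.I : ℂ)‖ ≤ 2 * r := by
      refine (Complex.norm_le_abs_re_add_abs_im _).trans ?_
      simp only [Complex.add_re, Complex.ofReal_re, Complex.mul_re, Complex.I_re, mul_zero,
        Complex.ofReal_im, Complex.I_im, mul_one, sub_self, add_zero, Complex.add_im,
        Complex.mul_im, zero_add]
      rw [abs_of_pos h1]
      linarith
    rw [norm_div, norm_mul, hn, norm_pow]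
    gcongr
  · intro t
    have h : ContinuousAt (fun η : ℝ => 4 * ε * Complex.I * (t + η * Complex.I) /
        ((t + η * Complex.I : ℂ) ^ 2 + (ε : ℂ) ^ 2) ^ 2) 0 := by
      refine ContinuousAt.div (by fun_prop) (by fun_prop) (pow_ne_zero _ ?_)
      have := norm_sq_add_sq_ge hε (t := t) le_rfl (by positivity)
      intro h0
      rw [h0, norm_zero] at this
      linarith [(by positivity : 0 < ε ^ 2 / 2)]
    have := h.tendsto.mono_left (nhdsWithin_le_nhds (s := Ioi 0))
    simpa using this
  · intro w h1 h2 h3 hw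
    have h := norm_sq_add_sq_ge_of_le_norm hε hr hw
    have hw : ‖w‖ ≤ 2 * r := by
      refine (Complex.norm_le_abs_re_add_abs_im _).trans ?_
      rw [abs_of_pos h2]
      linarith
    rw [norm_div, norm_mul, hn, norm_pow]
    calc _ ≤ 4 * ε * (2 * r) / (r ^ 2 / 2) ^ 2 := by gcongr
      _ = _ := by field_simp; ring
  · intro t ht
    rw [norm_div, norm_mul, hn, norm_pow, norm_ofReal_sq_add_sq hε, Complex.norm_real,
      Real.norm_eq_abs]
    have hκ0 : 0 ≤ κ := by
      have := (norm_nonneg _).trans (hκ r (abs_of_pos hr0).le)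
      exact nonneg_of_mul_nonneg_left this (by simpa using hr0.ne')
    calc _ ≤ 4 * ε * |t| / (t ^ 2 + ε ^ 2) ^ 2 * (κ * |t|) :=
          mul_le_mul_of_nonneg_left (hκ t ht) (by positivity)
      _ = 4 * κ * ε * t ^ 2 / (t ^ 2 + ε ^ 2) ^ 2 := by
          rw [← sq_abs t]; ring
      _ ≤ 4 * κ * ε * (t ^ 2 + ε ^ 2) / (t ^ 2 + ε ^ 2) ^ 2 := by
          gcongr; nlinarith
      _ = _ := by field_simp
  · intro η h1 h2
    have h1' : η < ε := by linarith
    have h2' : ε < r := by linarith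
    refine ⟨_, one_le_norm_rectIntegral_inv h1 h1' h2', ?_⟩
    have hne : ∀ w : ℂ, 0 < w.im → w + ε * Complex.I ≠ 0 := by
      intro w hw h
      have := congrArg Complex.im h
      simp at this hw
      linarith
    have hp : ∀ w : ℂ, 0 < w.im →
        HasDerivAt (fun w : ℂ => 4 * ε * Complex.I * w / (w + ε * Complex.I) ^ 2)
          ((4 * ε * Complex.I * (w + ε * Complex.I) ^ 2
            - 4 * ε * Complex.I * w * (2 * (w + ε * Complex.I))) /
              ((w + ε * Complex.I) ^ 2) ^ 2) w := by
      intro w hw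
      have h := ((hasDerivAt_id w).const_mul (4 * ε * Complex.I)).div
        (((hasDerivAt_id w).add_const (ε * Complex.I : ℂ)).pow 2) (pow_ne_zero 2 (hne w hw))
      simp at h
      exact h
    have hq : DifferentiableOn ℂ
        (fun w => (4 * ε * Complex.I * w / (w + ε * Complex.I) ^ 2) • G w) {w | 0 < w.im} :=
      DifferentiableOn.smul (fun w hw => (hp w hw).differentiableAt.differentiableWithinAt) hG
    have hz : 0 < (ε * Complex.I : ℂ).im := by simpa using hε
    have hGd : HasDerivAt G (deriv G (ε * Complex.I)) (ε * Complex.I) :=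
      (hG.differentiableAt ((isOpen_lt continuous_const Complex.continuous_im).mem_nhds
        hz)).hasDerivAt
    have hz2 : (ε * Complex.I + ε * Complex.I : ℂ) ≠ 0 := hne _ hz
    have hqd := ((hp _ hz).smul hGd).deriv
    have e1 : (4 * ε * Complex.I * (ε * Complex.I) / (ε * Complex.I + ε * Complex.I) ^ 2 : ℂ)
        = 1 := by
      rw [div_eq_one_iff_eq (pow_ne_zero 2 hz2)]; ring
    have e2 : (4 * ε * Complex.I * (ε * Complex.I + ε * Complex.I) ^ 2
            - 4 * ε * Complex.I * (ε * Complex.I) * (2 * (ε * Complex.I + ε * Complex.I)) : ℂ)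
        = 0 := by ring
    rw [e1, e2, zero_div, zero_smul, add_zero, one_smul] at hqd
    have h := rectIntegral_inv_sq_smul h1 h1' h2' hq
    have hqd' : deriv (fun w => (4 * ε * Complex.I * w / (w + ε * Complex.I) ^ 2) • G w)
      (ε * Complex.I) = deriv G (ε * Complex.I) := hqd
    rw [hqd'] at h
    rw [← h]
    refine rectIntegral_congr h1 h1' h2' fun w hw => ?_
    rw [smul_smul]
    congr 1
    have : w ^ 2 + (ε : ℂ) ^ 2 = (w - ε * Complex.I) * (w + ε * Complex.I) := by
      linear_combination (ε : ℂ) ^ 2 * Complex.I_sq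
    rw [this, mul_pow, div_eq_mul_inv, mul_inv, div_eq_mul_inv]
    ring

end Poisson

/-! ### Holomorphic functions with boundary values on an interval -/

section BoundaryValues

variable {E : Type*} [NormedAddCommGroup E] [NormedSpace ℂ E]

theorem differentiableOn_add_upper {G : ℂ → E} (hG : DifferentiableOn ℂ G {w | 0 < w.im})
    (lam : ℝ) : DifferentiableOn ℂ (fun w : ℂ => G (lam + w)) {w | 0 < w.im} :=
  hG.comp (by fun_prop) fun w hw => by simpa using hw

variable [CompleteSpace E]

/-- `norm_le_of_boundary_le` for `G - b lam` at the boundary point `lam`. -/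
theorem norm_sub_le_of_boundary {G : ℂ → E} {b : ℝ → E} {lam r ε κ M : ℝ} (hε : 0 < ε)
    (hr : 2 * ε ≤ r) (hG : DifferentiableOn ℂ G {w | 0 < w.im})
    (hM : ∀ w : ℂ, |w.re| ≤ r → 0 < w.im → w.im ≤ r → ‖G (lam + w)‖ ≤ M)
    (hb : ∀ t : ℝ, |t| ≤ r →
      Tendsto (fun η : ℝ => G ((lam + t : ℝ) + η * Complex.I)) (𝓝[>] 0) (𝓝 (b (lam + t))))
    (hκ : ∀ t : ℝ, |t| ≤ r → ‖b (lam + t) - b lam‖ ≤ κ) :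
    ‖G (lam + ε * Complex.I) - b lam‖ ≤ 2 * Real.pi * κ + 32 * M * ε / r := by
  have hr0 : 0 < r := by linarith
  have hbM : ‖b lam‖ ≤ M := by
    have h0 := hb 0 (by simpa using hr0.le)
    rw [add_zero] at h0
    refine le_of_tendsto h0.norm ?_
    filter_upwards [Ioc_mem_nhdsGT hr0] with η hη
    exact hM _ (by simpa using hr0.le) (by simpa using hη.1) (by simpa using hη.2)
  have key := norm_le_of_boundary_le (G := fun w => G (lam + w) - b lam)
    (b := fun t => b (lam + t) - b lam) (κ := κ) (M := 2 * M) hε hr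
    ((differentiableOn_add_upper hG lam).sub_const _)
    (fun w h1 h2 h3 => (norm_sub_le _ _).trans (by linarith [hM w h1 h2 h3]))
    (fun t ht => ?_) hκ
  · refine key.trans (le_of_eq ?_)
    ring
  · have := (hb t ht).sub_const (b lam)
    simpa [add_assoc] using this

/-- `norm_deriv_le_of_boundary_le` for `G` minus the first order Taylor polynomial of `b` at the
boundary point `lam`. -/
theorem norm_deriv_sub_le_of_boundary {G : ℂ → E} {b : ℝ → E} {b' : E} {lam r ε κ M M' : ℝ}
    (hε : 0 < ε) (hr : 2 * ε ≤ r) (hG : DifferentiableOn ℂ G {w | 0 < w.im})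
    (hM : ∀ w : ℂ, |w.re| ≤ r → 0 < w.im → w.im ≤ r → ‖G (lam + w)‖ ≤ M) (hM' : ‖b'‖ ≤ M')
    (hb : ∀ t : ℝ, |t| ≤ r →
      Tendsto (fun η : ℝ => G ((lam + t : ℝ) + η * Complex.I)) (𝓝[>] 0) (𝓝 (b (lam + t))))
    (hκ : ∀ t : ℝ, |t| ≤ r → ‖b (lam + t) - b lam - t • b'‖ ≤ κ * |t|) :
    ‖deriv G (lam + ε * Complex.I) - b'‖
      ≤ 4 * Real.pi * κ + 128 * (2 * M + 2 * r * M') * ε / r ^ 2 := by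
  have hr0 : 0 < r := by linarith
  have hbM : ‖b lam‖ ≤ M := by
    have h0 := hb 0 (by simpa using hr0.le)
    rw [add_zero] at h0
    refine le_of_tendsto h0.norm ?_
    filter_upwards [Ioc_mem_nhdsGT hr0] with η hη
    exact hM _ (by simpa using hr0.le) (by simpa using hη.1) (by simpa using hη.2)
  have hz : 0 < (lam + ε * Complex.I : ℂ).im := by simpa using hε
  have hGd : HasDerivAt G (deriv G (lam + ε * Complex.I)) (lam + ε * Complex.I) :=
    (hG.differentiableAt ((isOpen_lt continuous_const Complex.continuous_im).mem_nhds
      hz)).hasDerivAt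
  have hd : deriv (fun w : ℂ => G (lam + w) - b lam - w • b') (ε * Complex.I)
      = deriv G (lam + ε * Complex.I) - b' := by
    have h1 := HasDerivAt.comp_const_add (lam : ℂ) (ε * Complex.I : ℂ) hGd
    have h2 := (h1.sub_const (b lam)).sub ((hasDerivAt_id (ε * Complex.I : ℂ)).smul_const b')
    rw [one_smul] at h2
    exact h2.deriv
  rw [← hd]
  refine norm_deriv_le_of_boundary_le (b := fun t => b (lam + t) - b lam - t • b') hε hr
    (((differentiableOn_add_upper hG lam).sub_const _).sub (by fun_prop))
    (fun w h1 h2 h3 => ?_) (fun t ht => ?_) hκ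
  · have hw : ‖w‖ ≤ 2 * r := by
      refine (Complex.norm_le_abs_re_add_abs_im _).trans ?_
      rw [abs_of_pos h2]
      linarith
    have e1 : ‖w • b'‖ ≤ 2 * r * M' := by
      rw [norm_smul]
      exact mul_le_mul hw hM' (norm_nonneg _) (by positivity)
    have := norm_sub_le (G (lam + w) - b lam) (w • b')
    have := norm_sub_le (G (lam + w)) (b lam)
    have := hM w h1 h2 h3
    linarith
  · have h0 : Tendsto (fun η : ℝ => (t + η * Complex.I : ℂ) • b') (𝓝[>] 0) (𝓝 (t • b')) := by
      have : Continuous fun η : ℝ => (t + η * Complex.I : ℂ) • b' := by fun_prop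
      have := (this.tendsto 0).mono_left (nhdsWithin_le_nhds (s := Ioi 0))
      simpa using this
    have := ((hb t ht).sub_const (b lam)).sub h0
    simpa [add_assoc] using this

/-- A function `g` with non-negative imaginary part is controlled by its boundary values although
no bound on `g` is given: `1 / (g + i)` is bounded by `1`, so it is close to its boundary values,
and these are bounded away from zero. -/
theorem norm_le_of_im_nonneg {g : ℂ → ℂ} {b : ℝ → ℂ} {lam r ε κ N : ℝ} (hε : 0 < ε)
    (hr : 2 * ε ≤ r) (hg : DifferentiableOn ℂ g {w | 0 < w.im})
    (him : ∀ w : ℂ, 0 < w.im → 0 ≤ (g w).im)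
    (hb : ∀ t : ℝ, |t| ≤ r →
      Tendsto (fun η : ℝ => g ((lam + t : ℝ) + η * Complex.I)) (𝓝[>] 0) (𝓝 (b (lam + t))))
    (hκ : ∀ t : ℝ, |t| ≤ r → ‖b (lam + t) - b lam‖ ≤ κ) (hN : ‖b lam‖ ≤ N)
    (hsmall : 2 * Real.pi * κ + 32 * ε / r ≤ 1 / (2 * (N + 1))) :
    ‖g (lam + ε * Complex.I)‖ ≤ 2 * (N + 1) + 1 := by
  have hr0 : 0 < r := by linarith
  have hN0 : 0 ≤ N := (norm_nonneg _).trans hN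
  have hone : ∀ z : ℂ, 0 ≤ z.im → 1 ≤ ‖z + Complex.I‖ := fun z hz => by
    refine le_trans ?_ (Complex.abs_im_le_norm _)
    simp only [Complex.add_im, Complex.I_im]
    rw [abs_of_nonneg (by linarith)]
    linarith
  have hne : ∀ z : ℂ, 0 ≤ z.im → z + Complex.I ≠ 0 := fun z hz h => by
    have := hone z hz
    rw [h, norm_zero] at this
    linarith
  have hbim : ∀ t : ℝ, |t| ≤ r → 0 ≤ (b (lam + t)).im := fun t ht => by
    refine ge_of_tendsto ((Complex.continuous_im.tendsto _).comp (hb t ht)) ?_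
    filter_upwards [self_mem_nhdsWithin] with η hη
    exact him _ (by simpa using hη)
  have hb0 : 0 ≤ (b lam).im := by simpa using hbim 0 (by simpa using hr0.le)
  have key := norm_sub_le_of_boundary (G := fun w => (g w + Complex.I)⁻¹)
    (b := fun t => (b t + Complex.I)⁻¹) (lam := lam) (κ := κ) (M := 1) hε hr
    ((hg.add_const _).inv fun w hw => hne _ (him w hw))
    (fun w _ h2 _ => ?_) (fun t ht => ?_) (fun t ht => ?_)
  · rw [mul_one] at key
    have hz : 0 < (lam + ε * Complex.I : ℂ).im := by simpa using hε
    set x := g (lam + ε * Complex.I) with hx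
    have h1 : 1 / (N + 1) ≤ ‖(b lam + Complex.I)⁻¹‖ := by
      rw [norm_inv, ← one_div]
      refine one_div_le_one_div_of_le (by linarith [hone _ hb0]) ?_
      refine (norm_add_le _ _).trans ?_
      rw [Complex.norm_I]
      linarith
    have h2 : 1 / (2 * (N + 1)) ≤ ‖(x + Complex.I)⁻¹‖ := by
      have := norm_sub_norm_le (b lam + Complex.I)⁻¹ (x + Complex.I)⁻¹
      rw [norm_sub_rev] at this
      have e : 1 / (N + 1) = 1 / (2 * (N + 1)) + 1 / (2 * (N + 1)) := by field_simp; norm_num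
      linarith
    rw [norm_inv, ← one_div] at h2
    have hp : 0 < ‖x + Complex.I‖ := by linarith [hone x (him _ hz)]
    have h3 := (one_div_le_one_div (by positivity) hp).1 h2
    have := norm_sub_le (x + Complex.I) Complex.I
    rw [add_sub_cancel_right, Complex.norm_I] at this
    linarith
  · rw [norm_inv]
    exact inv_le_one_of_one_le₀ (hone _ (him _ (by simpa using h2)))
  · exact ((hb t ht).add_const _).inv₀ (hne _ (hbim t ht))
  · have e1 := hone _ hb0
    have e2 := hone _ (hbim t ht)
    rw [inv_sub_inv (hne _ (hbim t ht)) (hne _ hb0), norm_div, norm_mul]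
    refine (div_le_self (norm_nonneg _) (one_le_mul_of_one_le_of_one_le e2 e1)).trans ?_
    rw [add_sub_add_right_eq_sub, norm_sub_rev]
    exact hκ t ht

variable {G : ℂ → E} {B : ℝ → E} {U J : Set ℝ}

omit [CompleteSpace E] in
/-- Let `Φ` be a norming family of functionals and let `G` be holomorphic in the upper half-plane
with `Φ i ∘ G` of non-negative imaginary part. If `G` has continuous boundary values along the
vertical lines over `U`, then `G` is bounded near every compact subset of `U`. -/
theorem exists_bound_of_im_nonneg {ι : Type*} (Φ : ι → E →L[ℂ] ℂ) {c c' : ℝ}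
    (hc : ∀ i T, ‖Φ i T‖ ≤ c * ‖T‖) (hc' : ∀ T K, (∀ i, ‖Φ i T‖ ≤ K) → ‖T‖ ≤ c' * K)
    (hG : DifferentiableOn ℂ G {w | 0 < w.im})
    (him : ∀ i, ∀ w : ℂ, 0 < w.im → 0 ≤ (Φ i (G w)).im)
    (hU : IsOpen U) (hB : ContinuousOn B U)
    (hlim : ∀ lam ∈ U, Tendsto (fun η : ℝ => G (lam + η * Complex.I)) (𝓝[>] 0) (𝓝 (B lam)))
    (hJ : IsCompact J) (hJU : J ⊆ U) :
    ∃ ε₀ > 0, ∃ M : ℝ, ∀ lam ∈ J, ∀ ε : ℝ, 0 < ε → ε ≤ ε₀ →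
      ‖G (lam + ε * Complex.I)‖ ≤ M := by
  obtain ⟨δ, hδ, hsub⟩ := hJ.exists_cthickening_subset_open hU hJU
  have hK := hJ.cthickening (r := δ)
  obtain ⟨N₁, hN₁⟩ := hK.exists_bound_of_continuousOn (hB.mono hsub)
  set N := |c| * |N₁| with hN
  have hN0 : 0 ≤ N := by positivity
  have hc1 : ∀ i T, ‖Φ i T‖ ≤ (|c| + 1) * ‖T‖ := fun i T => (hc i T).trans
    (mul_le_mul_of_nonneg_right (by linarith [le_abs_self c]) (norm_nonneg _))
  have hπ := Real.pi_pos
  -- `κ` and the bound on `ε` make both terms of the smallness condition at most `1 / (4 (N + 1))`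
  set κ := 1 / (8 * Real.pi * (N + 1)) with hκ
  have hκ0 : 0 < κ := by positivity
  obtain ⟨ρ, hρ, hunif⟩ := Metric.uniformContinuousOn_iff.1
    (hK.uniformContinuousOn_of_continuous (hB.mono hsub)) (κ / (|c| + 1)) (by positivity)
  set r := min δ (ρ / 2) with hr
  have hr0 : 0 < r := by positivity
  have hrδ : r ≤ δ := min_le_left _ _
  have hrρ : r < ρ := (min_le_right _ _).trans_lt (by linarith)
  refine ⟨min (r / 2) (r / (128 * (N + 1))), by positivity, c' * (2 * (N + 1) + 1),
    fun lam hlam ε hε hεε => hc' _ _ fun i => ?_⟩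
  have h1 : 2 * ε ≤ r := by linarith [hεε.trans (min_le_left _ _)]
  have h2 : ε ≤ r / (128 * (N + 1)) := hεε.trans (min_le_right _ _)
  have hmem : ∀ t : ℝ, |t| ≤ r → lam + t ∈ Metric.cthickening δ J := fun t ht =>
    Metric.mem_cthickening_of_dist_le _ lam _ _ hlam (by simpa using ht.trans hrδ)
  have hmem0 : lam ∈ Metric.cthickening δ J := Metric.self_subset_cthickening _ hlam
  refine norm_le_of_im_nonneg (g := fun w => Φ i (G w)) (b := fun t => Φ i (B t)) (κ := κ) hε h1
    ((Φ i).differentiable.comp_differentiableOn hG) (him i)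
    (fun t ht => ((Φ i).continuous.tendsto _).comp (hlim _ (hsub (hmem t ht))))
    (fun t ht => ?_) ?_ ?_
  · rw [← map_sub]
    have := hunif _ (hmem t ht) _ hmem0 (by simpa using ht.trans_lt hrρ)
    rw [dist_eq_norm, lt_div_iff₀ (by positivity)] at this
    linarith [hc1 i (B (lam + t) - B lam)]
  · refine (hc i _).trans ?_
    exact mul_le_mul (le_abs_self _) ((hN₁ _ hmem0).trans (le_abs_self _)) (norm_nonneg _)
      (abs_nonneg _)
  · have e1 : 2 * Real.pi * κ = 1 / (4 * (N + 1)) := by rw [hκ]; field_simp; norm_num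
    have e2 : 32 * ε / r ≤ 1 / (4 * (N + 1)) := by
      rw [le_div_iff₀ (by positivity)] at h2
      rw [div_le_div_iff₀ hr0 (by positivity)]
      linarith
    have e3 : 1 / (2 * (N + 1)) = 1 / (4 * (N + 1)) + 1 / (4 * (N + 1)) := by
      field_simp; norm_num
    linarith

/-- A bounded holomorphic function whose boundary values are of class `C¹` converges to them
locally uniformly, together with its derivative. -/
theorem tendstoUniformlyOn_of_bounded
    (hG : DifferentiableOn ℂ G {w | 0 < w.im}) (hU : IsOpen U) (hB : ContDiffOn ℝ 1 B U)
    (hlim : ∀ lam ∈ U, Tendsto (fun η : ℝ => G (lam + η * Complex.I)) (𝓝[>] 0) (𝓝 (B lam)))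
    (hJ : IsCompact J) (hJU : J ⊆ U)
    (hbd : ∀ K : Set ℝ, IsCompact K → K ⊆ U → ∃ ε₀ > 0, ∃ M : ℝ, ∀ lam ∈ K, ∀ ε : ℝ, 0 < ε →
      ε ≤ ε₀ → ‖G (lam + ε * Complex.I)‖ ≤ M) :
    TendstoUniformlyOn (fun (ε lam : ℝ) => G (lam + ε * Complex.I)) B (𝓝[>] 0) J ∧
    TendstoUniformlyOn (fun (ε lam : ℝ) => deriv G (lam + ε * Complex.I)) (deriv B)
      (𝓝[>] 0) J := by
  obtain ⟨δ, hδ, hsub⟩ := hJ.exists_cthickening_subset_open hU hJU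
  have hK := hJ.cthickening (r := δ)
  obtain ⟨ε₀, hε₀, M, hM⟩ := hbd _ hK hsub
  have hdc : ContinuousOn (deriv B) U := hB.continuousOn_deriv_of_isOpen hU le_rfl
  have hdiff : ∀ t ∈ U, HasDerivAt B (deriv B t) t := fun t ht =>
    ((hB.differentiableOn one_ne_zero).differentiableAt (hU.mem_nhds ht)).hasDerivAt
  obtain ⟨M', hM'⟩ := hK.exists_bound_of_continuousOn (hdc.mono hsub)
  have hmem : ∀ lam ∈ J, ∀ t : ℝ, |t| ≤ δ → lam + t ∈ Metric.cthickening δ J :=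
    fun lam hlam t ht =>
      Metric.mem_cthickening_of_dist_le _ lam _ _ hlam (by simpa using ht)
  have hmem0 : ∀ lam ∈ J, lam ∈ Metric.cthickening δ J := fun lam hlam =>
    Metric.self_subset_cthickening _ hlam
  have hball : ∀ {r : ℝ}, r ≤ δ → r ≤ ε₀ → ∀ lam ∈ J, ∀ w : ℂ, |w.re| ≤ r → 0 < w.im →
      w.im ≤ r → ‖G (lam + w)‖ ≤ M := fun hrδ hrε lam hlam w h1 h2 h3 => by
    have := hM _ (hmem lam hlam w.re (h1.trans hrδ)) w.im h2 (h3.trans hrε)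
    rwa [Complex.ofReal_add, add_assoc, Complex.re_add_im] at this
  have hπ := Real.pi_pos
  -- the estimates above are of the form `e / 2 + C ε` for the choices of `κ` made below
  have hev : ∀ e r C : ℝ, 0 < e → 0 < r → ∀ᶠ ε : ℝ in 𝓝[>] 0,
      0 < ε ∧ 2 * ε ≤ r ∧ e / 2 + C * ε < e := fun e r C he hr => by
    have h1 : Tendsto (fun ε : ℝ => e / 2 + C * ε) (𝓝[>] 0) (𝓝 (e / 2 + C * 0)) :=
      (by fun_prop : Continuous fun ε : ℝ => e / 2 + C * ε).tendsto 0 |>.mono_left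
        nhdsWithin_le_nhds
    filter_upwards [h1.eventually_lt_const (show e / 2 + C * 0 < e by linarith),
      Ioc_mem_nhdsGT (show (0 : ℝ) < r / 2 by positivity)] with ε h2 h3
    exact ⟨h3.1, by linarith [h3.2], h2⟩
  constructor
  · rw [Metric.tendstoUniformlyOn_iff]
    intro e he
    obtain ⟨ρ, hρ, hunif⟩ := Metric.uniformContinuousOn_iff.1
      (hK.uniformContinuousOn_of_continuous (hB.continuousOn.mono hsub)) (e / (4 * Real.pi))
        (by positivity)
    set r := min (min δ ε₀) (ρ / 2) with hr
    have hr0 : 0 < r := by positivity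
    have hrδ : r ≤ δ := (min_le_left _ _).trans (min_le_left _ _)
    have hrε : r ≤ ε₀ := (min_le_left _ _).trans (min_le_right _ _)
    have hrρ : r < ρ := (min_le_right _ _).trans_lt (by linarith)
    filter_upwards [hev e r (32 * M / r) he hr0] with ε ⟨h1, h2, h3⟩ lam hlam
    rw [dist_comm, dist_eq_norm]
    refine (norm_sub_le_of_boundary (κ := e / (4 * Real.pi)) h1 h2 hG (hball hrδ hrε lam hlam)
      (fun t ht => hlim _ (hsub (hmem lam hlam t (ht.trans hrδ)))) fun t ht => ?_).trans_lt ?_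
    · rw [← dist_eq_norm]
      exact (hunif _ (hmem lam hlam t (ht.trans hrδ)) _ (hmem0 lam hlam)
        (by simpa using ht.trans_lt hrρ)).le
    · refine lt_of_eq_of_lt ?_ h3
      field_simp
      ring
  · rw [Metric.tendstoUniformlyOn_iff]
    intro e he
    obtain ⟨ρ, hρ, hunif⟩ := Metric.uniformContinuousOn_iff.1
      (hK.uniformContinuousOn_of_continuous (hdc.mono hsub)) (e / (8 * Real.pi))
        (by positivity)
    set r := min (min δ ε₀) (ρ / 2) with hr
    have hr0 : 0 < r := by positivity
    have hrδ : r ≤ δ := (min_le_left _ _).trans (min_le_left _ _)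
    have hrε : r ≤ ε₀ := (min_le_left _ _).trans (min_le_right _ _)
    have hrρ : r < ρ := (min_le_right _ _).trans_lt (by linarith)
    filter_upwards [hev e r (128 * (2 * M + 2 * r * M') / r ^ 2) he hr0]
      with ε ⟨h1, h2, h3⟩ lam hlam
    rw [dist_comm, dist_eq_norm]
    refine (norm_deriv_sub_le_of_boundary (b := B) (κ := e / (8 * Real.pi)) h1 h2 hG
      (hball hrδ hrε lam hlam) (hM' _ (hmem0 lam hlam))
      (fun t ht => hlim _ (hsub (hmem lam hlam t (ht.trans hrδ)))) fun t ht => ?_).trans_lt ?_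
    · have hmv := (convex_Icc (-r) r).norm_image_sub_le_of_norm_hasDerivWithin_le
        (f := fun x => B (lam + x) - x • deriv B lam)
        (f' := fun x => deriv B (lam + x) - deriv B lam) (C := e / (8 * Real.pi))
        (fun x hx => ?_) (fun x hx => ?_) (x := 0) (y := t) ⟨by linarith, hr0.le⟩ (abs_le.1 ht)
      · have e1 : B (lam + t) - B lam - t • deriv B lam
            = B (lam + t) - t • deriv B lam - (B (lam + 0) - (0 : ℝ) • deriv B lam) := by
          rw [add_zero, zero_smul]; abel
        rw [e1]
        simpa using hmv
      · have hx' := hmem lam hlam x ((abs_le.2 hx).trans hrδ)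
        have h4 := HasDerivAt.comp_const_add lam x (hdiff _ (hsub hx'))
        have h5 := h4.sub ((hasDerivAt_id x).smul_const (deriv B lam))
        rw [one_smul] at h5
        exact h5.hasDerivWithinAt
      · have hx' := hmem lam hlam x ((abs_le.2 hx).trans hrδ)
        rw [← dist_eq_norm]
        exact (hunif _ hx' _ (hmem0 lam hlam)
          (by simpa using (abs_le.2 hx).trans_lt hrρ)).le
    · refine lt_of_eq_of_lt ?_ h3
      field_simp
      ring

end BoundaryValues

/-! ### Resolvents of unbounded self-adjoint operators -/

section Resolvent

variable {E : Type u} [NormedAddCommGroup E] [InnerProductSpace ℂ E]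

theorem addBounded_apply (A : E →ₗ.[ℂ] E) (B : E →L[ℂ] E) (x : A.domain) :
    addBounded A B x = A x + B x := by
  rw [add_comm]; rfl

variable [CompleteSpace E] {A : E →ₗ.[ℂ] E} (hA : IsSelfAdjoint A)

include hA

theorem IsSelfAdjoint.inner_apply (x y : A.domain) :
    inner ℂ (A x) (y : E) = inner ℂ (x : E) (A y) := by
  have h := LinearPMap.adjoint_isFormalAdjoint hA.dense_domain
  rw [LinearPMap.isSelfAdjoint_def.1 hA] at h
  exact h x y

/-- The domain of the adjoint of `A` is contained in the domain of `A`. -/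
theorem IsSelfAdjoint.mem_domain_of_inner {y w : E}
    (h : ∀ x : A.domain, inner ℂ w (x : E) = inner ℂ y (A x)) :
    ∃ hy : y ∈ A.domain, A ⟨y, hy⟩ = w := by
  have key : ∃ hy : y ∈ A.adjoint.domain, A.adjoint ⟨y, hy⟩ = w :=
    ⟨LinearPMap.mem_adjoint_domain_of_exists y ⟨w, h⟩,
      LinearPMap.adjoint_apply_eq hA.dense_domain _ h⟩
  rwa [LinearPMap.isSelfAdjoint_def.1 hA] at key

theorem IsSelfAdjoint.addBounded {B : E →L[ℂ] E} (hB : IsSelfAdjoint B) :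
    IsSelfAdjoint (addBounded A B) := by
  have hd : Dense ((_root_.addBounded A B).domain : Set E) := hA.dense_domain
  have hBs : ∀ x y : E, inner ℂ (B x) y = inner ℂ x (B y) :=
    ContinuousLinearMap.isSelfAdjoint_iff_isSymmetric.1 hB
  have hsym : (_root_.addBounded A B).IsFormalAdjoint (_root_.addBounded A B) := fun x y => by
    have e1 := addBounded_apply A B x
    have e2 := addBounded_apply A B y
    rw [e1, e2, inner_add_left, inner_add_right, hA.inner_apply x y, hBs]
  have hle := hsym.le_adjoint hd
  rw [LinearPMap.isSelfAdjoint_def]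
  refine (LinearPMap.eq_of_le_of_domain_eq hle (le_antisymm hle.1 fun y hy => ?_)).symm
  obtain ⟨h, -⟩ := hA.mem_domain_of_inner (y := y)
    (w := (_root_.addBounded A B).adjoint ⟨y, hy⟩ - B y) fun x => by
      have h := LinearPMap.adjoint_isFormalAdjoint hd ⟨y, hy⟩ x
      have e2 := addBounded_apply A B x
      rw [e2, inner_add_right] at h
      rw [inner_sub_left, h, hBs]
      ring
  exact h

theorem IsSelfAdjoint.im_inner_sub (z : ℂ) (x : A.domain) :
    (inner ℂ (A x - z • (x : E)) (x : E)).im = z.im * ‖(x : E)‖ ^ 2 := by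
  have h : (inner ℂ (A x) (x : E)).im = 0 := by
    have := hA.inner_apply x x
    rw [← inner_conj_symm] at this
    exact Complex.conj_eq_iff_im.1 (by rw [inner_conj_symm, ← this, inner_conj_symm])
  rw [inner_sub_left, inner_smul_left, inner_self_eq_norm_sq_to_K, Complex.sub_im, h]
  have e : (RCLike.ofReal ‖(x : E)‖ : ℂ) ^ 2 = ((‖(x : E)‖ ^ 2 : ℝ) : ℂ) := by push_cast; rfl
  rw [e, Complex.mul_im, Complex.ofReal_re, Complex.ofReal_im]
  simp

theorem IsSelfAdjoint.norm_le_norm_sub (z : ℂ) (x : A.domain) :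
    |z.im| * ‖(x : E)‖ ≤ ‖A x - z • (x : E)‖ := by
  rcases eq_or_ne (x : E) 0 with h | h
  · rw [h, norm_zero, mul_zero]; exact norm_nonneg _
  · have h1 := hA.im_inner_sub z x
    have h2 := (Complex.abs_im_le_norm _).trans (norm_inner_le_norm (𝕜 := ℂ) (A x - z • (x : E)) x)
    rw [h1, abs_mul, abs_pow, abs_norm, sq, ← mul_assoc] at h2
    exact le_of_mul_le_mul_right h2 (norm_pos_iff.2 h)

/-- A non-real number lies in the resolvent set of a self-adjoint operator. -/
theorem IsSelfAdjoint.exists_isResolventAt {z : ℂ} (hz : z.im ≠ 0) :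
    ∃ R : E →L[ℂ] E, IsResolventAt A z R := by
  have hz0 : 0 < |z.im| := abs_pos.2 hz
  have hcl : _root_.IsClosed (A.graph : Set (E × E)) := hA.isClosed
  have : CompleteSpace A.graph := hcl.completeSpace_coe
  -- `A - z` as a bounded operator on the graph of `A`
  let g : A.graph →L[ℂ] E :=
    (ContinuousLinearMap.snd ℂ E E - z • ContinuousLinearMap.fst ℂ E E).comp A.graph.subtypeL
  have hg : ∀ p : A.graph, g p = (p : E × E).2 - z • (p : E × E).1 := fun p => rfl
  have hmem : ∀ p : A.graph, ∃ h : (p : E × E).1 ∈ A.domain,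
      A ⟨(p : E × E).1, h⟩ = (p : E × E).2 := fun p => by
    obtain ⟨x, h1, h2⟩ := LinearPMap.mem_graph_iff A |>.1 p.2
    exact ⟨h1 ▸ x.2, by rw [← h2]; congr 1; exact Subtype.ext h1.symm⟩
  have hb : ∀ p : A.graph, ‖(p : E × E).1‖ ≤ |z.im|⁻¹ * ‖g p‖ := fun p => by
    obtain ⟨h, hp⟩ := hmem p
    have := hA.norm_le_norm_sub z ⟨_, h⟩
    rw [hp] at this
    rw [← div_eq_inv_mul, le_div_iff₀ hz0, mul_comm]
    exact this
  -- it is bounded below, and the orthogonal complement of its range is an eigenspace of `A`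
  have hanti : AntilipschitzWith (1 + (‖z‖₊ + 1) * (‖z.im‖₊)⁻¹) g := by
    refine g.antilipschitz_of_bound fun p => ?_
    have h1 := hb p
    have h2 : ‖(p : E × E).2‖ ≤ ‖g p‖ + ‖z‖ * ‖(p : E × E).1‖ := by
      have := norm_add_le (g p) (z • (p : E × E).1)
      rwa [hg, sub_add_cancel, norm_smul, ← hg] at this
    have h3 : ‖z‖ * ‖(p : E × E).1‖ ≤ ‖z‖ * (|z.im|⁻¹ * ‖g p‖) :=
      mul_le_mul_of_nonneg_left h1 (norm_nonneg _)
    have h4 : ‖p‖ = max ‖(p : E × E).1‖ ‖(p : E × E).2‖ := rfl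
    have h5 : 0 ≤ |z.im|⁻¹ * ‖g p‖ := by positivity
    rw [h4]
    push_cast
    rw [Real.norm_eq_abs]
    refine max_le ?_ ?_
    · nlinarith [norm_nonneg (g p), norm_nonneg z, mul_nonneg (norm_nonneg z) h5]
    · nlinarith [norm_nonneg (g p), norm_nonneg z, mul_nonneg (norm_nonneg z) h5]
  have hker : LinearMap.ker (g : A.graph →ₗ[ℂ] E) = ⊥ := LinearMap.ker_eq_bot.2 hanti.injective
  have hclosed : _root_.IsClosed (LinearMap.range (g : A.graph →ₗ[ℂ] E) : Set E) := by
    rw [LinearMap.coe_range]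
    exact hanti.isClosed_range g.uniformContinuous
  have hrange : LinearMap.range (g : A.graph →ₗ[ℂ] E) = ⊤ := by
    have : CompleteSpace (LinearMap.range (g : A.graph →ₗ[ℂ] E)) := hclosed.completeSpace_coe
    rw [← Submodule.orthogonal_eq_bot_iff, Submodule.eq_bot_iff]
    intro y hy
    rw [Submodule.mem_orthogonal'] at hy
    obtain ⟨hd, hAy⟩ := hA.mem_domain_of_inner (y := y) (w := starRingEnd ℂ z • y) fun x => by
      have := hy (g ⟨(x, A x), A.mem_graph x⟩) ⟨_, rfl⟩
      rw [hg, inner_sub_right, inner_smul_right, sub_eq_zero] at this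
      rw [inner_smul_left, this, Complex.conj_conj]
    have := hA.norm_le_norm_sub (starRingEnd ℂ z) ⟨y, hd⟩
    rw [hAy, sub_self, norm_zero, Complex.conj_im, abs_neg] at this
    have : ‖y‖ ≤ 0 := nonpos_of_mul_nonpos_right this hz0
    exact norm_le_zero_iff.1 this
  let e := ContinuousLinearEquiv.ofBijective g hker hrange
  have he : ∀ y, g (e.symm y) = y := fun y => e.apply_symm_apply y
  refine ⟨((ContinuousLinearMap.fst ℂ E E).comp A.graph.subtypeL).comp
    (e.symm : E →L[ℂ] A.graph), fun y => ?_, fun x => ?_⟩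
  · obtain ⟨h, hp⟩ := hmem (e.symm y)
    refine ⟨h, ?_⟩
    have : A ⟨((e.symm y : A.graph) : E × E).1, h⟩ - z • ((e.symm y : A.graph) : E × E).1 = y := by
      rw [hp, ← hg, he]
    exact this
  · have : e.symm (A x - z • (x : E)) = ⟨(x, A x), A.mem_graph x⟩ := by
      rw [ContinuousLinearEquiv.symm_apply_eq]
      rfl
    show ((e.symm (A x - z • (x : E)) : A.graph) : E × E).1 = x
    rw [this]

theorem IsSelfAdjoint.isResolventAt {z : ℂ} (hz : z.im ≠ 0) :
    IsResolventAt A z (resolventOf A z) := by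
  unfold resolventOf
  rw [dif_pos (hA.exists_isResolventAt hz)]
  exact (hA.exists_isResolventAt hz).choose_spec

theorem IsSelfAdjoint.resolventOf_mem {z : ℂ} (hz : z.im ≠ 0) (y : E) :
    resolventOf A z y ∈ A.domain := ((hA.isResolventAt hz).1 y).1

theorem IsSelfAdjoint.apply_resolventOf {z : ℂ} (hz : z.im ≠ 0) (y : E) :
    A ⟨resolventOf A z y, hA.resolventOf_mem hz y⟩ = y + z • resolventOf A z y :=
  sub_eq_iff_eq_add.1 ((hA.isResolventAt hz).1 y).2

theorem IsSelfAdjoint.resolventOf_sub_apply {z : ℂ} (hz : z.im ≠ 0) (x : A.domain) :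
    resolventOf A z (A x - z • (x : E)) = x := (hA.isResolventAt hz).2 x

/-- The resolvent has non-negative imaginary part in the upper half-plane. -/
theorem IsSelfAdjoint.im_inner_resolventOf {z : ℂ} (hz : z.im ≠ 0) (f : E) :
    (inner ℂ f (resolventOf A z f)).im = z.im * ‖resolventOf A z f‖ ^ 2 := by
  have := hA.im_inner_sub z ⟨_, hA.resolventOf_mem hz f⟩
  rwa [hA.apply_resolventOf hz, add_sub_cancel_right] at this

theorem IsSelfAdjoint.norm_resolventOf_le {z : ℂ} (hz : z.im ≠ 0) :
    ‖resolventOf A z‖ ≤ |z.im|⁻¹ := by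
  refine ContinuousLinearMap.opNorm_le_bound _ (by positivity) fun y => ?_
  have := hA.norm_le_norm_sub z ⟨_, hA.resolventOf_mem hz y⟩
  rw [hA.apply_resolventOf hz, add_sub_cancel_right] at this
  rw [← div_eq_inv_mul, le_div_iff₀ (abs_pos.2 hz), mul_comm]
  exact this

theorem IsSelfAdjoint.inner_resolventOf_left {z : ℂ} (hz : z.im ≠ 0) (x y : E) :
    inner ℂ (resolventOf A z x) y = inner ℂ x (resolventOf A (starRingEnd ℂ z) y) := by
  have hz' : (starRingEnd ℂ z).im ≠ 0 := by simpa using hz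
  have h := hA.inner_apply ⟨_, hA.resolventOf_mem hz x⟩ ⟨_, hA.resolventOf_mem hz' y⟩
  rw [hA.apply_resolventOf hz, hA.apply_resolventOf hz', inner_add_left, inner_add_right,
    inner_smul_left, inner_smul_right] at h
  exact (add_right_cancel h).symm

/-- The second resolvent identity, for `A' = A + V` at `w` and `A` at `z`. -/
theorem IsSelfAdjoint.resolventOf_perturb {A' : E →ₗ.[ℂ] E} (hA' : IsSelfAdjoint A')
    {V : E →L[ℂ] E} (hV : A' = _root_.addBounded A V) {z w : ℂ} (hz : z.im ≠ 0) (hw : w.im ≠ 0)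
    (y : E) :
    resolventOf A' w y = resolventOf A z y + (w - z) • resolventOf A z (resolventOf A' w y)
      - resolventOf A z (V (resolventOf A' w y)) := by
  subst hV
  have hd : resolventOf (_root_.addBounded A V) w y ∈ A.domain := hA'.resolventOf_mem hw y
  have h1 := hA'.apply_resolventOf hw y
  have h2 := addBounded_apply A V ⟨_, hd⟩
  have h3 : A ⟨_, hd⟩ = y + w • resolventOf (_root_.addBounded A V) w y
      - V (resolventOf (_root_.addBounded A V) w y) := by
    rw [eq_sub_iff_add_eq, ← h1]; exact h2.symm
  have h4 := hA.resolventOf_sub_apply hz ⟨_, hd⟩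
  rw [h3] at h4
  simp only at h4
  conv_lhs => rw [← h4]
  simp only [map_add, map_sub, map_smul]
  module

theorem IsSelfAdjoint.resolventOf_sub_resolventOf {z w : ℂ} (hz : z.im ≠ 0) (hw : w.im ≠ 0) :
    resolventOf A w - resolventOf A z
      = (w - z) • (resolventOf A z).comp (resolventOf A w) := by
  ext y
  have hV : A = _root_.addBounded A 0 := by
    unfold _root_.addBounded
    rw [ContinuousLinearMap.toLinearMap_zero, zero_vadd]
  have h := hA.resolventOf_perturb hA hV hz hw y
  simp only [zero_apply, map_zero, sub_zero] at h
  exact sub_eq_iff_eq_add'.2 h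

theorem IsSelfAdjoint.continuousAt_resolventOf {z : ℂ} (hz : z.im ≠ 0) :
    ContinuousAt (resolventOf A) z := by
  rw [ContinuousAt, tendsto_iff_norm_sub_tendsto_zero]
  have hpos : 0 < |z.im| / 2 := by have := abs_pos.2 hz; positivity
  have hev : ∀ᶠ w : ℂ in 𝓝 z, |z.im| / 2 < |w.im| :=
    (Complex.continuous_im.abs.tendsto z).eventually_const_lt (by linarith)
  have hlim : Tendsto (fun w : ℂ => ‖w - z‖ * (|z.im|⁻¹ * (|z.im| / 2)⁻¹)) (𝓝 z) (𝓝 0) := by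
    have : Continuous fun w : ℂ => ‖w - z‖ * (|z.im|⁻¹ * (|z.im| / 2)⁻¹) := by fun_prop
    simpa using this.tendsto z
  refine squeeze_zero' (Eventually.of_forall fun _ => norm_nonneg _) ?_ hlim
  filter_upwards [hev] with w hw
  have hw0 : w.im ≠ 0 := abs_pos.1 (hpos.trans hw)
  rw [hA.resolventOf_sub_resolventOf hz hw0, norm_smul]
  refine mul_le_mul_of_nonneg_left ((ContinuousLinearMap.opNorm_comp_le _ _).trans ?_)
    (norm_nonneg _)
  exact mul_le_mul (hA.norm_resolventOf_le hz)
    ((hA.norm_resolventOf_le hw0).trans (inv_anti₀ hpos hw.le)) (norm_nonneg _) (by positivity)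

theorem IsSelfAdjoint.hasDerivAt_resolventOf {z : ℂ} (hz : z.im ≠ 0) :
    HasDerivAt (resolventOf A) ((resolventOf A z).comp (resolventOf A z)) z := by
  rw [hasDerivAt_iff_tendsto_slope]
  have hc : Tendsto (fun w => (resolventOf A z).comp (resolventOf A w)) (𝓝[≠] z)
      (𝓝 ((resolventOf A z).comp (resolventOf A z))) :=
    (((ContinuousLinearMap.compL ℂ E E E (resolventOf A z)).continuous.tendsto _).comp
      (hA.continuousAt_resolventOf hz).tendsto).mono_left nhdsWithin_le_nhds
  refine hc.congr' ?_
  have hev : ∀ᶠ w : ℂ in 𝓝 z, w.im ≠ 0 :=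
    Complex.continuous_im.continuousAt.eventually_ne hz
  filter_upwards [nhdsWithin_le_nhds hev, self_mem_nhdsWithin] with w hw hne
  rw [slope_def_module, hA.resolventOf_sub_resolventOf hz hw, smul_smul,
    inv_mul_cancel₀ (sub_ne_zero.2 hne), one_smul]

end Resolvent

/-! ### From pointwise to uniform limiting absorption -/

namespace HilbertScale

variable {X : ℝ → Type u} [∀ s, NormedAddCommGroup (X s)] [∀ s, InnerProductSpace ℂ (X s)]
  [∀ s, CompleteSpace (X s)] (S : HilbertScale X) {s : ℝ} (hs : 0 ≤ s)

/-- `toDualOp` as a bounded linear map. -/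
noncomputable def toDualOpCLM : (X 0 →L[ℂ] X 0) →L[ℂ] (X s →L[ℂ] X (-s)) :=
  (ContinuousLinearMap.compL ℂ (X s) (X 0) (X (-s)) (S.emb (neg_nonpos.2 hs))).comp
    ((ContinuousLinearMap.compL ℂ (X s) (X 0) (X 0)).flip (S.emb hs))

omit [∀ s, CompleteSpace (X s)] in
theorem pairing_toDualOp (T : X 0 →L[ℂ] X 0) (f g : X s) :
    S.pairing s (S.toDualOp hs T f) g = inner ℂ (T (S.emb hs f)) (S.emb hs g) :=
  S.pairing_nonneg hs _ g

omit [∀ s, CompleteSpace (X s)] in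
theorem norm_pairing_le (u : X (-s)) (f : X s) :
    ‖S.pairing s u f‖
      ≤ ‖(S.pairing s : X (-s) →SL[starRingEnd ℂ] StrongDual ℂ (X s))‖ * ‖u‖ * ‖f‖ :=
  ((S.pairing s u).le_opNorm f).trans (mul_le_mul_of_nonneg_right
    ((S.pairing s : X (-s) →SL[starRingEnd ℂ] StrongDual ℂ (X s)).le_opNorm u) (norm_nonneg _))

/-- The quadratic form `T ↦ ⟨f, T f⟩` of an operator `T ∈ L(X s, X (-s))`; the conjugate of the
pairing makes it linear in `T`. -/
noncomputable def quadForm (f : X s) : (X s →L[ℂ] X (-s)) →L[ℂ] ℂ :=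
  LinearMap.mkContinuous
    { toFun := fun T => starRingEnd ℂ (S.pairing s (T f) f)
      map_add' := fun T T' => by simp
      map_smul' := fun c T => by simp }
    (‖(S.pairing s : X (-s) →SL[starRingEnd ℂ] StrongDual ℂ (X s))‖ * ‖f‖ * ‖f‖) fun T => by
      simp only [LinearMap.coe_mk, AddHom.coe_mk, RCLike.norm_conj]
      refine (S.norm_pairing_le _ _).trans ?_
      have := T.le_opNorm f
      calc _ ≤ ‖(S.pairing s : X (-s) →SL[starRingEnd ℂ] StrongDual ℂ (X s))‖
              * (‖T‖ * ‖f‖) * ‖f‖ := by gcongr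
        _ = _ := by ring

omit [∀ s, CompleteSpace (X s)] in
theorem quadForm_apply (f : X s) (T : X s →L[ℂ] X (-s)) :
    S.quadForm f T = starRingEnd ℂ (S.pairing s (T f) f) := rfl

omit [∀ s, CompleteSpace (X s)] in
theorem norm_quadForm_le {f : X s} (hf : ‖f‖ ≤ 1) (T : X s →L[ℂ] X (-s)) :
    ‖S.quadForm f T‖
      ≤ ‖(S.pairing s : X (-s) →SL[starRingEnd ℂ] StrongDual ℂ (X s))‖ * ‖T‖ := by
  rw [quadForm_apply, RCLike.norm_conj]
  refine (S.norm_pairing_le _ _).trans ?_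
  have h1 : ‖T f‖ ≤ ‖T‖ * 1 := (T.le_opNorm f).trans (by gcongr)
  calc _ ≤ ‖(S.pairing s : X (-s) →SL[starRingEnd ℂ] StrongDual ℂ (X s))‖ * (‖T‖ * 1) * 1 := by
        gcongr
    _ = _ := by ring

omit [∀ s, CompleteSpace (X s)] in
/-- The quadratic forms on the unit ball are a norming family, by polarization. -/
theorem norm_le_of_quadForm_le {T : X s →L[ℂ] X (-s)} {K : ℝ}
    (h : ∀ f : X s, ‖f‖ ≤ 1 → ‖S.quadForm f T‖ ≤ K) :
    ‖T‖ ≤ 4 * ‖((S.pairing s).symm : StrongDual ℂ (X s) →SL[starRingEnd ℂ] X (-s))‖ * K := by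
  have hK : 0 ≤ K := (norm_nonneg _).trans (h 0 (by simp))
  have hq : ∀ f : X s, ‖f‖ ≤ 1 → ‖S.pairing s (T f) f‖ ≤ K := fun f hf => by
    have := h f hf
    rwa [quadForm_apply, RCLike.norm_conj] at this
  have hpol : ∀ f g : X s, 4 * S.pairing s (T f) g
      = (S.pairing s (T (f + g)) (f + g) - S.pairing s (T (f - g)) (f - g))
        - Complex.I * (S.pairing s (T (f + Complex.I • g)) (f + Complex.I • g)
          - S.pairing s (T (f - Complex.I • g)) (f - Complex.I • g)) := fun f g => by
    simp only [map_add, map_sub, map_smul, map_smulₛₗ, add_apply, sub_apply, smul_apply,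
      Complex.conj_I, smul_eq_mul]
    linear_combination (2 * S.pairing s (T f) g - 2 * S.pairing s (T g) f) * Complex.I_sq
  have hhalf : ∀ f g : X s, ‖f‖ ≤ 1 / 2 → ‖g‖ ≤ 1 / 2 → ‖S.pairing s (T f) g‖ ≤ K :=
    fun f g hf hg => by
    have hg' : ‖Complex.I • g‖ ≤ 1 / 2 := by rwa [norm_smul, Complex.norm_I, one_mul]
    have h1 := hq (f + g) ((norm_add_le _ _).trans (by linarith))
    have h2 := hq (f - g) ((norm_sub_le _ _).trans (by linarith))
    have h3 := hq (f + Complex.I • g) ((norm_add_le _ _).trans (by linarith))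
    have h4 := hq (f - Complex.I • g) ((norm_sub_le _ _).trans (by linarith))
    have h5 := congrArg norm (hpol f g)
    rw [norm_mul] at h5
    have h6 := h5.le.trans (norm_sub_le _ _)
    rw [show ‖(4 : ℂ)‖ = 4 by simp, norm_mul, Complex.norm_I, one_mul] at h6
    have h7 := h6.trans (add_le_add (norm_sub_le _ _) (norm_sub_le _ _))
    linarith
  have hunit : ∀ f : X s, ‖f‖ = 1 → ‖S.pairing s (T f)‖ ≤ 4 * K := fun f hf => by
    refine ContinuousLinearMap.opNorm_le_of_unit_norm (by positivity) fun g hg => ?_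
    have := hhalf ((2 : ℂ)⁻¹ • f) ((2 : ℂ)⁻¹ • g) (by rw [norm_smul, hf]; simp)
      (by rw [norm_smul, hg]; simp)
    simp only [map_smul, map_smulₛₗ, smul_apply, smul_eq_mul, norm_mul,
      RCLike.norm_conj, norm_inv, Complex.norm_ofNat] at this
    linarith
  refine ContinuousLinearMap.opNorm_le_of_unit_norm (by positivity) fun f hf => ?_
  have h1 := ((S.pairing s).symm : StrongDual ℂ (X s) →SL[starRingEnd ℂ] X (-s)).le_opNorm
    (S.pairing s (T f))
  have h2 : ((S.pairing s).symm : StrongDual ℂ (X s) →SL[starRingEnd ℂ] X (-s))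
    (S.pairing s (T f)) = T f := (S.pairing s).symm_apply_apply (T f)
  rw [h2] at h1
  refine h1.trans ((mul_le_mul_of_nonneg_left (hunit f hf) (norm_nonneg _)).trans (le_of_eq ?_))
  ring

variable {A : X 0 →ₗ.[ℂ] X 0} (hA : IsSelfAdjoint A)
include hA

theorem hasDerivAt_scaleResolvent {z : ℂ} (hz : z.im ≠ 0) :
    HasDerivAt (S.scaleResolvent hs A)
      (S.toDualOp hs ((resolventOf A z).comp (resolventOf A z))) z :=
  (S.toDualOpCLM hs).hasFDerivAt.comp_hasDerivAt z (hA.hasDerivAt_resolventOf hz)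

theorem deriv_scaleResolvent_ofReal {lam : ℝ} {w : ℂ} (hw : (lam + w : ℂ).im ≠ 0) :
    deriv (fun t : ℝ => S.scaleResolvent hs A (t + w)) lam
      = deriv (S.scaleResolvent hs A) (lam + w) := by
  have h := S.hasDerivAt_scaleResolvent hs hA hw
  have h' := HasDerivAt.scomp lam (HasDerivAt.comp_add_const (lam : ℂ) w h)
    (Complex.ofRealCLM.hasDerivAt (x := lam))
  rw [Complex.ofRealCLM_apply, Complex.ofReal_one, one_smul] at h'
  exact h'.deriv.trans h.deriv.symm

theorem im_quadForm_scaleResolvent {z : ℂ} (hz : z.im ≠ 0) (f : X s) :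
    (S.quadForm f (S.scaleResolvent hs A z)).im
      = z.im * ‖resolventOf A z (S.emb hs f)‖ ^ 2 := by
  rw [quadForm_apply, scaleResolvent, pairing_toDualOp, inner_conj_symm,
    hA.im_inner_resolventOf hz]

theorem uniformLimits_of_tendstoUniformlyOn {J : Set ℝ} {σ : ℝ} (hσ : σ ≠ 0)
    {B : ℝ → (X s →L[ℂ] X (-s))} (hB : ∀ t ∈ J, HasDerivAt B (deriv B t) t)
    (h0 : TendstoUniformlyOn (fun (ε lam : ℝ) => S.scaleResolvent hs A (lam + σ * ε * Complex.I)) B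
      (𝓝[>] 0) J)
    (h1 : TendstoUniformlyOn
      (fun (ε lam : ℝ) => deriv (S.scaleResolvent hs A) (lam + σ * ε * Complex.I)) (deriv B)
      (𝓝[>] 0) J) :
    S.UniformLimits hs A 1 J σ := by
  refine ⟨fun j => if j = 0 then B else deriv B, fun j hj => ?_, fun j hj lam hlam => ?_⟩
  · interval_cases j
    · simpa using h0
    · simp only [iteratedDeriv_one, one_ne_zero, if_false]
      refine h1.congr ?_
      filter_upwards [self_mem_nhdsWithin] with ε hε lam _
      have hz : (lam + σ * ε * Complex.I : ℂ).im ≠ 0 := by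
        simpa using ⟨hσ, ne_of_gt (show (0 : ℝ) < ε from hε)⟩
      exact (S.deriv_scaleResolvent_ofReal hs hA hz).symm
  · obtain rfl : j = 0 := by omega
    simpa using (hB lam hlam).hasDerivWithinAt

/-- For a self-adjoint operator, limits of class `C¹` of the resolvent at each point of an open
set are automatically attained locally uniformly, together with the first derivatives. The limits
from below reduce to those from above by passing to `w ↦ -(A + w)⁻¹`. -/
theorem uniformLimits_of_limitingAbsorption {U J : Set ℝ} (hU : IsOpen U)
    (h : S.LimitingAbsorption hs A 1 U) (hJ : IsCompact J) (hJU : J ⊆ U) :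
    S.UniformLimits hs A 1 J 1 ∧ S.UniformLimits hs A 1 J (-1) := by
  obtain ⟨Bp, Bm, hBp, hBm, hlim⟩ := h
  -- the common part: `G` is the resolvent, or its mirror image in the upper half-plane
  have key : ∀ {G : ℂ → (X s →L[ℂ] X (-s))} {B : ℝ → (X s →L[ℂ] X (-s))} {V K : Set ℝ},
      DifferentiableOn ℂ G {w | 0 < w.im} →
      (∀ f : X s, ∀ w : ℂ, 0 < w.im → 0 ≤ (S.quadForm f (G w)).im) → IsOpen V →
      ContDiffOn ℝ 1 B V →
      (∀ lam ∈ V, Tendsto (fun η : ℝ => G (lam + η * Complex.I)) (𝓝[>] 0) (𝓝 (B lam))) →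
      IsCompact K → K ⊆ V →
      TendstoUniformlyOn (fun (ε lam : ℝ) => G (lam + ε * Complex.I)) B (𝓝[>] 0) K ∧
      TendstoUniformlyOn (fun (ε lam : ℝ) => deriv G (lam + ε * Complex.I)) (deriv B)
        (𝓝[>] 0) K := fun hG him hV hB hl hK hKV =>
    tendstoUniformlyOn_of_bounded hG hV hB hl hK hKV fun K' hK' hKV' =>
      exists_bound_of_im_nonneg (fun f : {f : X s // ‖f‖ ≤ 1} => S.quadForm (f : X s))
        (fun f T => S.norm_quadForm_le f.2 T)
        (fun T K h => S.norm_le_of_quadForm_le fun f hf => h ⟨f, hf⟩) hG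
        (fun f => him f) hV hB.continuousOn hl hK' hKV'
  have hdiff : ∀ {B : ℝ → (X s →L[ℂ] X (-s))}, ContDiffOn ℝ 1 B U →
      ∀ t ∈ U, HasDerivAt B (deriv B t) t := fun hB t ht =>
    ((hB.differentiableOn one_ne_zero).differentiableAt (hU.mem_nhds ht)).hasDerivAt
  constructor
  · obtain ⟨h0, h1⟩ := key (G := S.scaleResolvent hs A)
      (fun w hw => (S.hasDerivAt_scaleResolvent hs hA
        (ne_of_gt (show 0 < w.im from hw))).differentiableAt.differentiableWithinAt)
      (fun f w hw => by
        rw [S.im_quadForm_scaleResolvent hs hA hw.ne']; positivity)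
      hU hBp (fun lam hlam => (hlim lam hlam).1) hJ hJU
    exact S.uniformLimits_of_tendstoUniformlyOn hs hA one_ne_zero
      (fun t ht => hdiff hBp t (hJU ht)) (by simpa using h0) (by simpa using h1)
  · have hderiv : ∀ w : ℂ, 0 < w.im → HasDerivAt (fun w => -S.scaleResolvent hs A (-w))
        (deriv (S.scaleResolvent hs A) (-w)) w := fun w hw => by
      have h := S.hasDerivAt_scaleResolvent hs hA (z := -w) (by simpa using hw.ne')
      rw [h.deriv]
      have := (h.scomp w (hasDerivAt_neg w)).neg
      simp only [neg_smul, one_smul, neg_neg] at this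
      exact this
    obtain ⟨h0, h1⟩ := key (G := fun w => -S.scaleResolvent hs A (-w)) (B := fun t => -Bm (-t))
      (V := Neg.neg ⁻¹' U) (K := Neg.neg ⁻¹' J)
      (fun w hw => (hderiv w hw).differentiableAt.differentiableWithinAt)
      (fun f w hw => by
        rw [map_neg, Complex.neg_im,
          S.im_quadForm_scaleResolvent hs hA (by simpa using hw.ne'), Complex.neg_im, neg_mul,
          neg_neg]
        positivity)
      (hU.preimage continuous_neg)
      ((hBm.comp contDiff_neg.contDiffOn fun t ht => ht).neg)
      (fun lam hlam => by
        have := (hlim _ hlam).2.neg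
        refine this.congr fun ε => ?_
        congr 2
        push_cast
        ring)
      ((Homeomorph.neg ℝ).isCompact_preimage.2 hJ)
      (preimage_mono hJU)
    have hpre : (Neg.neg ⁻¹' (Neg.neg ⁻¹' J) : Set ℝ) = J := by
      ext t; simp
    refine S.uniformLimits_of_tendstoUniformlyOn hs hA (by norm_num)
      (fun t ht => hdiff hBm t (hJU ht)) ?_ ?_
    · have h2 := (h0.comp (Neg.neg : ℝ → ℝ)).neg
      rw [hpre] at h2
      refine (h2.congr (Eventually.of_forall fun ε lam _ => ?_)).congr_right fun lam _ => ?_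
      · simp only [Pi.neg_apply, Function.comp_apply, neg_neg]
        congr 1
        push_cast
        ring
      · simp
    · have h2 := h1.comp (Neg.neg : ℝ → ℝ)
      rw [hpre] at h2
      refine (h2.congr ?_).congr_right fun lam hlam => ?_
      · filter_upwards [self_mem_nhdsWithin] with ε hε lam _
        simp only [Function.comp_apply]
        rw [(hderiv _ (by simpa using hε)).deriv]
        congr 1
        push_cast
        ring
      · simp only [Function.comp_apply]
        have h3 := ((hdiff hBm lam (hJU hlam)))
        rw [← neg_neg lam] at h3
        have := (h3.scomp (-lam) (hasDerivAt_neg (-lam))).neg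
        simp only [neg_smul, one_smul, neg_neg] at this
        exact this.deriv

end HilbertScale

/-! ### Stability of limiting absorption under small perturbations -/

namespace HilbertScale

variable {X : ℝ → Type u} [∀ s, NormedAddCommGroup (X s)] [∀ s, InnerProductSpace ℂ (X s)]
  [∀ s, CompleteSpace (X s)] (S : HilbertScale X) {s : ℝ} (hs : 0 ≤ s)

/-- `T ↦ (1 + T W)⁻¹ T`, which maps the resolvent of `A` to the resolvent of `A + W`. -/
noncomputable def perturbResolvent (W : X (-s) →L[ℂ] X s) (T : X s →L[ℂ] X (-s)) :
    X s →L[ℂ] X (-s) :=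
  (Ring.inverse (1 + T.comp W : X (-s) →L[ℂ] X (-s))).comp T

theorem isUnit_one_add_comp {W : X (-s) →L[ℂ] X s} {T : X s →L[ℂ] X (-s)}
    (h : ‖T‖ * ‖W‖ < 1) : IsUnit (1 + T.comp W : X (-s) →L[ℂ] X (-s)) := by
  have := isUnit_one_sub_of_norm_lt_one (x := -(T.comp W))
    (by rw [norm_neg]; exact (T.opNorm_comp_le W).trans_lt h)
  rwa [sub_neg_eq_add] at this

theorem contDiffAt_perturbResolvent {W : X (-s) →L[ℂ] X s} {T : X s →L[ℂ] X (-s)}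
    (h : IsUnit (1 + T.comp W : X (-s) →L[ℂ] X (-s))) :
    ContDiffAt ℂ 1 (perturbResolvent W) T := by
  obtain ⟨x, hx⟩ := h
  have h1 : ContDiffAt ℂ 1 (Ring.inverse : (X (-s) →L[ℂ] X (-s)) → _) (1 + T.comp W) := by
    rw [← hx]; exact contDiffAt_ringInverse ℂ x
  have h2 : ContDiffAt ℂ 1 (fun T : X s →L[ℂ] X (-s) => (1 + T.comp W : X (-s) →L[ℂ] X (-s))) T :=
    contDiffAt_const.add (contDiffAt_id.clm_comp contDiffAt_const)
  exact (ContDiffAt.comp T h1 h2).clm_comp contDiffAt_id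

variable {A : X 0 →ₗ.[ℂ] X 0} (hA : IsSelfAdjoint A)
include hA

theorem scaleResolvent_addBounded {W : X (-s) →L[ℂ] X s} (hW : IsSelfAdjoint (S.toOp hs W))
    {z : ℂ} (hz : z.im ≠ 0)
    (h : IsUnit (1 + (S.scaleResolvent hs A z).comp W : X (-s) →L[ℂ] X (-s))) :
    S.scaleResolvent hs (addBounded A (S.toOp hs W)) z
      = perturbResolvent W (S.scaleResolvent hs A z) := by
  have key : (1 + (S.scaleResolvent hs A z).comp W : X (-s) →L[ℂ] X (-s)).comp
      (S.scaleResolvent hs (addBounded A (S.toOp hs W)) z) = S.scaleResolvent hs A z := by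
    ext f
    have h1 := hA.resolventOf_perturb (hA.addBounded hW) rfl hz hz (S.emb hs f)
    rw [sub_self, zero_smul, add_zero] at h1
    have h2 := congrArg (S.emb (neg_nonpos.2 hs)) h1
    rw [map_sub, eq_sub_iff_add_eq] at h2
    exact h2
  have hinv := Ring.inverse_mul_cancel _ h
  rw [ContinuousLinearMap.mul_def] at hinv
  have e := congrArg ((Ring.inverse (1 + (S.scaleResolvent hs A z).comp W :
    X (-s) →L[ℂ] X (-s))).comp) key
  rw [← ContinuousLinearMap.comp_assoc, hinv] at e
  exact e

/-- If the resolvent of `A` has boundary values of class `C¹` on an open set, then so has the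
resolvent of `A + W` near a given compact subset, for all sufficiently small `W`. -/
theorem exists_limitingAbsorption_addBounded {U J : Set ℝ} (hU : IsOpen U)
    (h : S.LimitingAbsorption hs A 1 U) (hJ : IsCompact J) (hJU : J ⊆ U) :
    ∃ γ > 0, ∀ W : X (-s) →L[ℂ] X s, IsSelfAdjoint (S.toOp hs W) → ‖W‖ < γ →
      ∃ V : Set ℝ, IsOpen V ∧ J ⊆ V ∧
        S.LimitingAbsorption hs (addBounded A (S.toOp hs W)) 1 V := by
  obtain ⟨Bp, Bm, hBp, hBm, hlim⟩ := h
  obtain ⟨δ, hδ, hsub⟩ := hJ.exists_cthickening_subset_open hU hJU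
  have hK := hJ.cthickening (r := δ)
  obtain ⟨N, hN⟩ := hK.exists_bound_of_continuousOn (hBp.continuousOn.mono hsub)
  obtain ⟨N', hN'⟩ := hK.exists_bound_of_continuousOn (hBm.continuousOn.mono hsub)
  refine ⟨1 / (|N| + |N'| + 1), by positivity, fun W hW hWγ => ?_⟩
  rw [lt_div_iff₀ (by positivity)] at hWγ
  have hVK := Metric.thickening_subset_cthickening δ J
  refine ⟨Metric.thickening δ J, Metric.isOpen_thickening, Metric.self_subset_thickening hδ J, ?_⟩
  have hsmall : ∀ T : X s →L[ℂ] X (-s), (‖T‖ ≤ N ∨ ‖T‖ ≤ N') →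
      IsUnit (1 + T.comp W : X (-s) →L[ℂ] X (-s)) := fun T hT => by
    refine isUnit_one_add_comp ?_
    have h1 : ‖T‖ ≤ |N| + |N'| := by
      rcases hT with hT | hT
      · exact (hT.trans (le_abs_self _)).trans (by linarith [abs_nonneg N'])
      · exact (hT.trans (le_abs_self _)).trans (by linarith [abs_nonneg N])
    nlinarith [norm_nonneg W, mul_le_mul_of_nonneg_right h1 (norm_nonneg W)]
  have hup : ∀ lam ∈ Metric.thickening δ J, IsUnit (1 + (Bp lam).comp W : X (-s) →L[ℂ] X (-s)) :=
    fun lam hlam => hsmall _ (Or.inl (hN _ (hVK hlam)))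
  have hum : ∀ lam ∈ Metric.thickening δ J, IsUnit (1 + (Bm lam).comp W : X (-s) →L[ℂ] X (-s)) :=
    fun lam hlam => hsmall _ (Or.inr (hN' _ (hVK hlam)))
  have htend : ∀ {p : ℝ → ℂ} {T : X s →L[ℂ] X (-s)}, (∀ ε > 0, (p ε).im ≠ 0) →
      IsUnit (1 + T.comp W : X (-s) →L[ℂ] X (-s)) →
      Tendsto (fun ε => S.scaleResolvent hs A (p ε)) (𝓝[>] 0) (𝓝 T) →
      Tendsto (fun ε => S.scaleResolvent hs (addBounded A (S.toOp hs W)) (p ε)) (𝓝[>] 0)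
        (𝓝 (perturbResolvent W T)) := fun {p T} hp hT ht => by
    have hc : Continuous fun T : X s →L[ℂ] X (-s) => (1 + T.comp W : X (-s) →L[ℂ] X (-s)) := by
      fun_prop
    refine ((contDiffAt_perturbResolvent hT).continuousAt.tendsto.comp ht).congr' ?_
    filter_upwards [self_mem_nhdsWithin,
      ht.eventually (hc.continuousAt.eventually (Units.isOpen.mem_nhds hT))] with ε hε hu
    exact (S.scaleResolvent_addBounded hs hA hW (hp ε hε) hu).symm
  refine ⟨fun t => perturbResolvent W (Bp t), fun t => perturbResolvent W (Bm t),
    fun t ht => ?_, fun t ht => ?_, fun lam hlam => ⟨?_, ?_⟩⟩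
  · exact ((contDiffAt_perturbResolvent (hup t ht)).restrict_scalars ℝ).comp_contDiffWithinAt t
      ((hBp t (hsub (hVK ht))).mono (hVK.trans hsub))
  · exact ((contDiffAt_perturbResolvent (hum t ht)).restrict_scalars ℝ).comp_contDiffWithinAt t
      ((hBm t (hsub (hVK ht))).mono (hVK.trans hsub))
  · exact htend (fun ε hε => by simpa using ne_of_gt hε) (hup lam hlam)
      (hlim lam (hsub (hVK hlam))).1
  · exact htend (fun ε hε => by simpa using ne_of_gt hε) (hum lam hlam)
      (hlim lam (hsub (hVK hlam))).2

end HilbertScale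

/-! ### Boundary values of the resolvent on vectors of `X s` -/

/-- A bounded family which converges weakly against a dense range converges weakly. -/
theorem tendsto_inner_of_denseRange {E F ι : Type*} [NormedAddCommGroup E] [InnerProductSpace ℂ E]
    {l : Filter ι} {r : ι → E} {u : E} {M : ℝ} (hM : ∀ᶠ i in l, ‖r i‖ ≤ M) {e : F → E}
    (he : DenseRange e)
    (h : ∀ g : F, Tendsto (fun i => inner ℂ (r i) (e g)) l (𝓝 (inner ℂ u (e g)))) (y : E) :
    Tendsto (fun i => inner ℂ (r i) y) l (𝓝 (inner ℂ u y)) := by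
  rw [Metric.tendsto_nhds]
  intro δ hδ
  set K := |M| + ‖u‖ + 1 with hK
  have hK0 : 0 < K := by positivity
  obtain ⟨g, hg⟩ := he.exists_dist_lt y (show 0 < δ / (2 * K) by positivity)
  filter_upwards [hM, (Metric.tendsto_nhds.1 (h g)) (δ / 2) (by positivity)] with i h1 h2
  rw [dist_eq_norm, ← inner_sub_left] at h2 ⊢
  have h3 : inner ℂ (r i - u) y = inner ℂ (r i - u) (e g) + inner ℂ (r i - u) (y - e g) := by
    rw [← inner_add_right, add_sub_cancel]
  have h4 : ‖r i - u‖ ≤ K := (norm_sub_le _ _).trans (by linarith [le_abs_self M])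
  have h5 : ‖inner ℂ (r i - u) (y - e g)‖ ≤ K * (δ / (2 * K)) := by
    refine (norm_inner_le_norm _ _).trans ?_
    rw [dist_eq_norm] at hg
    exact mul_le_mul h4 hg.le (norm_nonneg _) hK0.le
  have h6 : K * (δ / (2 * K)) = δ / 2 := by field_simp
  rw [h3]
  exact (norm_add_le _ _).trans_lt (by linarith)

namespace HilbertScale

variable {X : ℝ → Type u} [∀ s, NormedAddCommGroup (X s)] [∀ s, InnerProductSpace ℂ (X s)]
  [∀ s, CompleteSpace (X s)] (S : HilbertScale X) {s : ℝ} (hs : 0 ≤ s)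

variable {A : X 0 →ₗ.[ℂ] X 0} (hA : IsSelfAdjoint A)

theorem im_add_mul_I (lam ε : ℝ) : (lam + ε * Complex.I : ℂ).im = ε := by simp

theorem im_add_mul_I_ne {lam ε : ℝ} (hε : 0 < ε) : (lam + ε * Complex.I : ℂ).im ≠ 0 := by
  rw [Complex.add_im]; simpa using hε.ne'

include hA in
theorem _root_.IsSelfAdjoint.norm_resolventOf_conj {z : ℂ} (hz : z.im ≠ 0) (f : X 0) :
    ‖resolventOf A (starRingEnd ℂ z) f‖ = ‖resolventOf A z f‖ := by
  have hz' : (starRingEnd ℂ z).im ≠ 0 := by simpa using hz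
  have h1 := hA.im_inner_resolventOf hz f
  have h2 := hA.im_inner_resolventOf hz' f
  rw [← hA.inner_resolventOf_left hz, ← inner_conj_symm, Complex.conj_im, h1, Complex.conj_im,
    neg_mul, neg_inj] at h2
  have h3 := mul_left_cancel₀ hz h2
  exact ((sq_eq_sq₀ (norm_nonneg _) (norm_nonneg _)).1 h3).symm

variable {lam : ℝ} {B : X s →L[ℂ] X (-s)}
  (hB : Tendsto (fun ε : ℝ => S.scaleResolvent hs A (lam + ε * Complex.I)) (𝓝[>] 0) (𝓝 B))

include hA hB

/-- The resolvent has no pole-like growth at `lam`: `ε R(lam + i ε) f → 0` in norm for `f ∈ X s`,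
because `ε ‖R f‖² = Im ⟨f, R f⟩` converges. -/
theorem tendsto_norm_smul_resolventOf (f : X s) :
    Tendsto (fun ε : ℝ => ε * ‖resolventOf A (lam + ε * Complex.I) (S.emb hs f)‖) (𝓝[>] 0)
      (𝓝 0) := by
  have h1 : Tendsto (fun ε : ℝ => (S.quadForm f (S.scaleResolvent hs A
      (lam + ε * Complex.I))).im) (𝓝[>] 0) (𝓝 (S.quadForm f B).im) :=
    (Complex.continuous_im.tendsto _).comp (((S.quadForm f).continuous.tendsto _).comp hB)
  have h2 : Tendsto (fun ε : ℝ => ε) (𝓝[>] 0) (𝓝 0) := nhdsWithin_le_nhds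
  have h3 := (Real.continuous_sqrt.tendsto _).comp (h2.mul h1)
  rw [zero_mul, Real.sqrt_zero] at h3
  refine h3.congr' ?_
  filter_upwards [self_mem_nhdsWithin] with ε hε
  have hε' : 0 < ε := hε
  simp only [Function.comp_apply]
  rw [S.im_quadForm_scaleResolvent hs hA (im_add_mul_I_ne hε'), im_add_mul_I, ← mul_assoc, ← sq,
    ← mul_pow, Real.sqrt_sq (by positivity)]

/-- If `(A - lam) x = y`, then `R(lam + i 0) y` is `x`, weakly against `X s`. -/
theorem tendsto_inner_resolventOf (x : A.domain) (f : X s) :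
    Tendsto (fun ε : ℝ => inner ℂ (S.emb hs f)
      (resolventOf A (lam + ε * Complex.I) (A x - (lam : ℂ) • (x : X 0)))) (𝓝[>] 0)
      (𝓝 (inner ℂ (S.emb hs f) (x : X 0))) := by
  rw [tendsto_iff_norm_sub_tendsto_zero]
  have h1 := (S.tendsto_norm_smul_resolventOf hs hA hB f).mul_const ‖(x : X 0)‖
  rw [zero_mul] at h1
  refine squeeze_zero' (Eventually.of_forall fun _ => norm_nonneg _) ?_ h1
  filter_upwards [self_mem_nhdsWithin] with ε hε
  have hε' : 0 < ε := hε
  have hz := im_add_mul_I_ne (lam := lam) hε'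
  set z : ℂ := lam + ε * Complex.I with hzdef
  have h2 := hA.resolventOf_sub_apply hz x
  have h3 : A x - (lam : ℂ) • (x : X 0)
      = A x - z • (x : X 0) + (ε * Complex.I : ℂ) • (x : X 0) := by
    rw [hzdef]; module
  rw [h3, map_add, h2, inner_add_right, add_sub_cancel_left, map_smul, inner_smul_right]
  have h4 : inner ℂ (S.emb hs f) (resolventOf A z x)
      = inner ℂ (resolventOf A (starRingEnd ℂ z) (S.emb hs f)) (x : X 0) := by
    rw [hA.inner_resolventOf_left (by simpa using hz), Complex.conj_conj]
  rw [h4, norm_mul, norm_mul, Complex.norm_I, mul_one, Complex.norm_real,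
    Real.norm_of_nonneg hε'.le, mul_assoc]
  refine mul_le_mul_of_nonneg_left ?_ hε'.le
  rw [← hA.norm_resolventOf_conj hz]
  exact norm_inner_le_norm _ _

/-- If `Im ⟨f, R(lam + i 0) f⟩ = 0` and the derivative of the resolvent in `L(X s, X (-s))` has a
limit, then `R(lam + i ε) f` is bounded in `X 0`: indeed `ε ‖R f‖² = Im ⟨f, R f⟩` vanishes at
`ε = 0` and has bounded derivative. -/
theorem exists_norm_resolventOf_le {f : X s} (hf : (S.quadForm f B).im = 0)
    {B' : X s →L[ℂ] X (-s)}
    (hB' : Tendsto (fun ε : ℝ => deriv (S.scaleResolvent hs A) (lam + ε * Complex.I)) (𝓝[>] 0)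
      (𝓝 B')) :
    ∃ M, ∀ᶠ ε : ℝ in 𝓝[>] 0, ‖resolventOf A (lam + ε * Complex.I) (S.emb hs f)‖ ≤ M := by
  set φ : ℝ → ℂ := fun ε => S.quadForm f (S.scaleResolvent hs A (lam + ε * Complex.I)) with hφ
  have hd : ∀ ε : ℝ, 0 < ε → HasDerivAt φ
      (S.quadForm f (Complex.I • deriv (S.scaleResolvent hs A) (lam + ε * Complex.I))) ε :=
    fun ε hε => by
    have h := S.hasDerivAt_scaleResolvent hs hA (im_add_mul_I_ne (lam := lam) hε)
    have h1 := ((Complex.ofRealCLM.hasDerivAt (x := ε)).mul_const Complex.I).const_add (lam : ℂ)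
    have h2 := h.scomp ε h1
    rw [Complex.ofRealCLM_apply, Complex.ofReal_one, one_mul, ← h.deriv] at h2
    exact ((S.quadForm f).hasFDerivAt.restrictScalars ℝ).comp_hasDerivAt ε h2
  set K := ‖S.quadForm f‖ * (‖B'‖ + 1) with hK
  have hev : ∀ᶠ ε : ℝ in 𝓝[>] 0,
      ‖deriv (S.scaleResolvent hs A) (lam + ε * Complex.I)‖ < ‖B'‖ + 1 :=
    hB'.norm.eventually_lt_const (by linarith)
  obtain ⟨ε₁, hε₁, hsub⟩ := mem_nhdsGT_iff_exists_Ioc_subset.1 hev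
  have hε₁' : 0 < ε₁ := hε₁
  have hmv : ∀ x ∈ Ioc 0 ε₁, ∀ y ∈ Ioc 0 ε₁, ‖φ y - φ x‖ ≤ K * ‖y - x‖ := fun x hx y hy =>
    (convex_Ioc 0 ε₁).norm_image_sub_le_of_norm_hasDerivWithin_le
      (fun t ht => (hd t ht.1).hasDerivWithinAt) (fun t ht => by
        refine ((S.quadForm f).le_opNorm _).trans ?_
        rw [norm_smul, Complex.norm_I, one_mul]
        exact mul_le_mul_of_nonneg_left (le_of_lt (hsub ht)) (norm_nonneg _)) hx hy
  have hφ0 : Tendsto φ (𝓝[>] 0) (𝓝 (S.quadForm f B)) :=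
    ((S.quadForm f).continuous.tendsto _).comp hB
  refine ⟨Real.sqrt K, ?_⟩
  filter_upwards [Ioc_mem_nhdsGT hε₁'] with ε hε
  have hle : ‖φ ε - S.quadForm f B‖ ≤ K * ε := by
    refine le_of_tendsto_of_tendsto (f := fun x : ℝ => ‖φ ε - φ x‖) (g := fun x => K * ‖ε - x‖)
      (tendsto_const_nhds.sub hφ0).norm ?_ ?_ (b := 𝓝[>] 0)
    · have : Continuous fun x : ℝ => K * ‖ε - x‖ := by fun_prop
      have := (this.tendsto 0).mono_left (nhdsWithin_le_nhds (s := Ioi 0))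
      simpa [abs_of_pos hε.1] using this
    · filter_upwards [Ioc_mem_nhdsGT hε₁'] with x hx
      exact hmv x hx ε hε
  have h1 := (Complex.abs_im_le_norm _).trans hle
  rw [Complex.sub_im, hf, sub_zero, hφ, S.im_quadForm_scaleResolvent hs hA (im_add_mul_I_ne hε.1),
    im_add_mul_I] at h1
  have h2 := (le_abs_self _).trans h1
  rw [mul_comm K] at h2
  exact Real.le_sqrt_of_sq_le (le_of_mul_le_mul_left h2 hε.1)

/-- If `R(lam + i ε) f` stays bounded in `X 0`, then it converges weakly to a solution `u` of
`(A - lam) u = f`. -/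
theorem exists_weak_limit (hdense : DenseRange (S.emb hs)) {f : X s} {M : ℝ}
    (hM : ∀ᶠ ε : ℝ in 𝓝[>] 0, ‖resolventOf A (lam + ε * Complex.I) (S.emb hs f)‖ ≤ M) :
    ∃ u : A.domain, A u = S.emb hs f + (lam : ℂ) • (u : X 0) ∧
      ∀ y : X 0, Tendsto (fun ε : ℝ =>
        inner ℂ (resolventOf A (lam + ε * Complex.I) (S.emb hs f)) y) (𝓝[>] 0)
        (𝓝 (inner ℂ (u : X 0) y)) := by
  have hlim : ∀ g : X s, Tendsto (fun ε : ℝ =>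
      inner ℂ (resolventOf A (lam + ε * Complex.I) (S.emb hs f)) (S.emb hs g)) (𝓝[>] 0)
      (𝓝 (S.pairing s (B f) g)) := fun g => by
    have hc : Continuous fun T : X s →L[ℂ] X (-s) => S.pairing s (T f) g :=
      ((ContinuousLinearMap.apply ℂ ℂ g).continuous.comp (S.pairing s).continuous).comp
        (ContinuousLinearMap.apply ℂ (X (-s)) f).continuous
    refine ((hc.tendsto _).comp hB).congr fun ε => ?_
    exact S.pairing_toDualOp hs _ f g
  have hnorm : ∀ g : X s, ‖S.pairing s (B f) g‖ ≤ M * ‖S.emb hs g‖ := fun g => by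
    refine le_of_tendsto (hlim g).norm ?_
    filter_upwards [hM] with ε hε
    exact (norm_inner_le_norm _ _).trans (mul_le_mul_of_nonneg_right hε (norm_nonneg _))
  set ℓ : X 0 →L[ℂ] ℂ := LinearMap.extendOfNorm
    (S.pairing s (B f) : X s →ₗ[ℂ] ℂ) (S.emb hs : X s →ₗ[ℂ] X 0) with hℓ
  have hℓe : ∀ g : X s, ℓ (S.emb hs g) = S.pairing s (B f) g := fun g =>
    LinearMap.extendOfNorm_eq (e := (S.emb hs : X s →ₗ[ℂ] X 0)) hdense ⟨M, hnorm⟩ g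
  set u := (InnerProductSpace.toDual ℂ (X 0)).symm ℓ with hu
  have hue : ∀ y : X 0, inner ℂ u y = ℓ y := fun y => InnerProductSpace.toDual_symm_apply
  have hweak : ∀ y : X 0, Tendsto (fun ε : ℝ =>
        inner ℂ (resolventOf A (lam + ε * Complex.I) (S.emb hs f)) y) (𝓝[>] 0)
        (𝓝 (inner ℂ u y)) :=
    tendsto_inner_of_denseRange hM hdense fun g => by rw [hue, hℓe]; exact hlim g
  obtain ⟨hud, hAu⟩ := hA.mem_domain_of_inner (y := u) (w := S.emb hs f + (lam : ℂ) • u)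
    fun x => by
    have h1 := hweak (A x)
    have h2 : Tendsto (fun ε : ℝ => inner ℂ (S.emb hs f) (x : X 0)
        + starRingEnd ℂ (lam + ε * Complex.I : ℂ)
          * inner ℂ (resolventOf A (lam + ε * Complex.I) (S.emb hs f)) (x : X 0)) (𝓝[>] 0)
        (𝓝 (inner ℂ (S.emb hs f) (x : X 0) + starRingEnd ℂ (lam : ℂ) * inner ℂ u (x : X 0))) := by
      have hc : Continuous fun ε : ℝ => starRingEnd ℂ (lam + ε * Complex.I : ℂ) :=
        Complex.continuous_conj.comp (by fun_prop)
      have h3 := (hc.tendsto 0).mono_left (nhdsWithin_le_nhds (s := Ioi 0))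
      simp only [Complex.ofReal_zero, zero_mul, add_zero] at h3
      exact tendsto_const_nhds.add (h3.mul (hweak x))
    have h4 := tendsto_nhds_unique h1 (h2.congr' ?_)
    · rw [inner_add_left, inner_smul_left, h4]
    · filter_upwards [self_mem_nhdsWithin] with ε hε
      have hz := im_add_mul_I_ne (lam := lam) (show 0 < ε from hε)
      have h5 := hA.inner_apply ⟨_, hA.resolventOf_mem hz (S.emb hs f)⟩ x
      rw [hA.apply_resolventOf hz, inner_add_left, inner_smul_left] at h5
      exact h5
  exact ⟨⟨u, hud⟩, hAu, hweak⟩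

end HilbertScale

/-! ### The eigenprojection and the eigenvalue criterion -/

section Eigenprojection

variable {E : Type u} [NormedAddCommGroup E] [InnerProductSpace ℂ E] [CompleteSpace E]

theorem isSelfAdjoint_eigenprojection (A : E →ₗ.[ℂ] E) (z : ℂ) :
    IsSelfAdjoint (eigenprojection A z) :=
  isSelfAdjoint_starProjection _

theorem inner_eigenprojection (A : E →ₗ.[ℂ] E) (z : ℂ) (x y : E) :
    inner ℂ (eigenprojection A z x) y = inner ℂ x (eigenprojection A z y) :=
  ContinuousLinearMap.isSelfAdjoint_iff_isSymmetric.1 (isSelfAdjoint_eigenprojection A z) x y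

theorem eigenprojection_eigenprojection (A : E →ₗ.[ℂ] E) (z : ℂ) (x : E) :
    eigenprojection A z (eigenprojection A z x) = eigenprojection A z x :=
  Submodule.starProjection_eq_self_iff.2 (Submodule.starProjection_apply_mem _ x)

theorem eigenprojection_of_mem {A : E →ₗ.[ℂ] E} {z : ℂ} {x : E} (hx : x ∈ eigenspaceOf A z) :
    eigenprojection A z x = x :=
  Submodule.starProjection_eq_self_iff.2 ((eigenspaceOf A z).le_topologicalClosure hx)

theorem eigenprojection_mem {A : E →ₗ.[ℂ] E} {z : ℂ}
    (hfin : FiniteDimensional ℂ (eigenspaceOf A z)) (x : E) :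
    eigenprojection A z x ∈ eigenspaceOf A z := by
  have h := Submodule.starProjection_apply_mem (eigenspaceOf A z).topologicalClosure x
  have hcl := (eigenspaceOf A z).closed_of_finiteDimensional.submodule_topologicalClosure_eq
  exact hcl ▸ h

end Eigenprojection

namespace HilbertScale

variable {X : ℝ → Type u} [∀ s, NormedAddCommGroup (X s)] [∀ s, InnerProductSpace ℂ (X s)]
  [∀ s, CompleteSpace (X s)] (S : HilbertScale X) {s : ℝ} (hs : 0 ≤ s)

/-- The adjoint `X (-s) → X 0` of `T : X 0 → X s` for the duality pairing. -/
noncomputable def pairingAdjoint (T : X 0 →L[ℂ] X s) : X (-s) →L[ℂ] X 0 :=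
  ((InnerProductSpace.toDual ℂ (X 0)).symm.toContinuousLinearEquiv :
      StrongDual ℂ (X 0) →SL[starRingEnd ℂ] X 0).comp
    (((ContinuousLinearMap.compL ℂ (X 0) (X s) ℂ).flip T).comp
      (S.pairing s : X (-s) →SL[starRingEnd ℂ] StrongDual ℂ (X s)))

theorem inner_pairingAdjoint (T : X 0 →L[ℂ] X s) (v : X (-s)) (g : X 0) :
    inner ℂ (S.pairingAdjoint T v) g = S.pairing s v (T g) :=
  InnerProductSpace.toDual_symm_apply

variable {H : X 0 →ₗ.[ℂ] X 0} {lam₀ : ℝ}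

/-- The eigenprojection maps boundedly into `X s`, since the eigenspace is a finite-dimensional
subspace of `X s`. -/
theorem H2.exists_lift {S : HilbertScale X} (h : S.H2 H lam₀) :
    ∃ T : X 0 →L[ℂ] X s, ∀ x, S.emb hs (T x) = eigenprojection H lam₀ x := by
  have hfin := h.finite
  have hcomap : eigenspaceOf H lam₀ ≤ LinearMap.range (S.emb hs : X s →ₗ[ℂ] X 0) := by
    intro φ hφ
    obtain ⟨f, hf⟩ := h.regular φ hφ s hs
    exact ⟨f, hf⟩
  let e := LinearEquiv.ofInjective (S.emb hs : X s →ₗ[ℂ] X 0) (S.emb_injective hs)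
  let L : eigenspaceOf H lam₀ →ₗ[ℂ] X s :=
    (e.symm : LinearMap.range (S.emb hs : X s →ₗ[ℂ] X 0) →ₗ[ℂ] X s).comp
      (Submodule.inclusion hcomap)
  have hL : ∀ x, S.emb hs (L x) = (x : X 0) := fun x => by
    have := e.apply_symm_apply (Submodule.inclusion hcomap x)
    exact congrArg Subtype.val this
  let P : X 0 →L[ℂ] eigenspaceOf H lam₀ :=
    (eigenprojection H lam₀).codRestrict _ (eigenprojection_mem hfin)
  exact ⟨(LinearMap.toContinuousLinearMap L).comp P, fun x => hL (P x)⟩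

/-- `P₀ R P₀` factors through the resolvent regarded as an operator from `X s` to `X (-s)`. -/
theorem Qop_eq {T : X 0 →L[ℂ] X s} (hT : ∀ x, S.emb hs (T x) = eigenprojection H lam₀ x)
    (W : X (-s) →L[ℂ] X s) (z : ℂ) :
    S.Qop hs H lam₀ W z = (S.pairingAdjoint T).comp
      ((S.scaleResolvent hs (addBounded (shifted H lam₀) (S.toOp hs W)) z).comp T) := by
  ext g
  refine ext_inner_right ℂ fun y => ?_
  have h := S.inner_pairingAdjoint T
    (S.scaleResolvent hs (addBounded (shifted H lam₀) (S.toOp hs W)) z (T g)) y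
  rw [scaleResolvent, pairing_toDualOp, hT, hT, ← inner_eigenprojection] at h
  exact h.symm

/-- Uniform limits give limits of the resolvent and of its derivative at each point. -/
theorem UniformLimits.exists_tendsto {S : HilbertScale X} {A : X 0 →ₗ.[ℂ] X 0}
    (hA : IsSelfAdjoint A) {J : Set ℝ} (h : S.UniformLimits hs A 1 J 1) {lam : ℝ} (hlam : lam ∈ J) :
    ∃ B B' : X s →L[ℂ] X (-s),
      Tendsto (fun ε : ℝ => S.scaleResolvent hs A (lam + ε * Complex.I)) (𝓝[>] 0) (𝓝 B) ∧
      Tendsto (fun ε : ℝ => deriv (S.scaleResolvent hs A) (lam + ε * Complex.I)) (𝓝[>] 0)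
        (𝓝 B') := by
  obtain ⟨D, hD, -⟩ := h
  refine ⟨D 0 lam, D 1 lam, ?_, ?_⟩
  · simpa using (hD 0 zero_le_one).tendsto_at hlam
  · refine ((hD 1 le_rfl).tendsto_at hlam).congr' ?_
    filter_upwards [self_mem_nhdsWithin] with ε hε
    rw [iteratedDeriv_one]
    simp only [Complex.ofReal_one, one_mul]
    exact S.deriv_scaleResolvent_ofReal hs hA (im_add_mul_I_ne hε)

/-- The Birman–Schwinger type correspondence between the eigenvalue `1` of `Q = P₀ R(lam + i 0) P₀`
and the eigenvalue `lam` of `H + W = A - P₀`, where `R` is the resolvent of `A = H + P₀ + W`. An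
eigenvector `x` of `H + W` gives the eigenvector `P₀ x` of `Q`, and an eigenvector `ψ` of `Q` gives
the eigenvector `R(lam + i 0) ψ` of `H + W`. -/
theorem hasEigenvalue_one_iff {W : X (-s) →L[ℂ] X s}
    (hA : IsSelfAdjoint (addBounded (shifted H lam₀) (S.toOp hs W)))
    (hdense : DenseRange (S.emb hs)) {T : X 0 →L[ℂ] X s}
    (hT : ∀ x, S.emb hs (T x) = eigenprojection H lam₀ x) {lam : ℝ} {B B' : X s →L[ℂ] X (-s)}
    {Q : X 0 →L[ℂ] X 0}
    (hB : Tendsto (fun ε : ℝ => S.scaleResolvent hs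
      (addBounded (shifted H lam₀) (S.toOp hs W)) (lam + ε * Complex.I)) (𝓝[>] 0) (𝓝 B))
    (hB' : Tendsto (fun ε : ℝ => deriv (S.scaleResolvent hs
      (addBounded (shifted H lam₀) (S.toOp hs W))) (lam + ε * Complex.I)) (𝓝[>] 0) (𝓝 B'))
    (hQ : Tendsto (fun ε : ℝ => S.Qop hs H lam₀ W (lam + ε * Complex.I)) (𝓝[>] 0) (𝓝 Q)) :
    Module.End.HasEigenvalue (Q : X 0 →ₗ[ℂ] X 0) 1 ↔
      IsEigenvalueOf (addBounded H (S.toOp hs W)) lam := by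
  set P₀ := eigenprojection H lam₀ with hP₀
  set A := addBounded (shifted H lam₀) (S.toOp hs W) with hAdef
  have hAx : ∀ x : H.domain, A x = addBounded H (S.toOp hs W) x + P₀ x := fun x => by
    have e1 := addBounded_apply (shifted H lam₀) (S.toOp hs W) x
    have e2 := addBounded_apply H P₀ x
    have e3 := addBounded_apply H (S.toOp hs W) x
    have e4 : A x = H x + P₀ x + S.toOp hs W x := e1.trans (congrArg (· + S.toOp hs W x) e2)
    rw [e4, e3]
    abel
  have hQlim : ∀ x y : X 0, Tendsto (fun ε : ℝ => inner ℂ (P₀ x)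
      (resolventOf A (lam + ε * Complex.I) (P₀ y))) (𝓝[>] 0) (𝓝 (inner ℂ x (Q y))) :=
    fun x y => by
    have hc : Continuous fun T : X 0 →L[ℂ] X 0 => (inner ℂ x (T y) : ℂ) := by fun_prop
    refine ((hc.tendsto _).comp hQ).congr fun ε => ?_
    exact (inner_eigenprojection H lam₀ x _).symm
  have hPQ : ∀ y, P₀ (Q y) = Q y := fun y => by
    refine ext_inner_left ℂ fun x => ?_
    rw [← inner_eigenprojection]
    refine tendsto_nhds_unique (hQlim _ y) ((hQlim x y).congr fun ε => ?_)
    rw [eigenprojection_eigenprojection]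
  constructor
  · intro hev
    obtain ⟨ψ, hψ, hψ0⟩ := hev.exists_hasEigenvector
    have hQψ : Q ψ = ψ := by
      have := Module.End.mem_eigenspace_iff.1 hψ
      simpa using this
    have hPψ : P₀ ψ = ψ := by
      have := hPQ ψ
      rwa [hQψ] at this
    have hTψ : S.emb hs (T ψ) = ψ := (hT ψ).trans hPψ
    -- `⟨ψ, R(lam + i 0) ψ⟩ = ⟨ψ, Q ψ⟩ = ‖ψ‖²` is real
    have him : (S.quadForm (T ψ) B).im = 0 := by
      have h1 : Tendsto (fun ε : ℝ => S.quadForm (T ψ) (S.scaleResolvent hs A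
          (lam + ε * Complex.I))) (𝓝[>] 0) (𝓝 (inner ℂ ψ (Q ψ))) := by
        refine (hQlim ψ ψ).congr fun ε => ?_
        rw [quadForm_apply, scaleResolvent, pairing_toDualOp, inner_conj_symm, hTψ, hPψ]
      rw [tendsto_nhds_unique (((S.quadForm (T ψ)).continuous.tendsto _).comp hB) h1, hQψ]
      exact inner_self_im (𝕜 := ℂ) ψ
    obtain ⟨M, hM⟩ := S.exists_norm_resolventOf_le hs hA hB him hB'
    obtain ⟨u, hAu, hweak⟩ := S.exists_weak_limit hs hA hB hdense hM
    rw [hTψ] at hAu hweak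
    have hPu : P₀ (u : X 0) = ψ := by
      refine ext_inner_right ℂ fun g => ?_
      rw [inner_eigenprojection]
      refine tendsto_nhds_unique (hweak (P₀ g)) ?_
      have h1 := (Complex.continuous_conj.tendsto _).comp (hQlim g ψ)
      rw [hQψ, inner_conj_symm] at h1
      refine h1.congr fun ε => ?_
      rw [Function.comp_apply, inner_conj_symm, hPψ]
    refine ⟨u, fun hu => hψ0 ?_, ?_⟩
    · rw [← hPu, hu, map_zero]
    · have h1 := hAx u
      rw [hPu] at h1
      have h2 : addBounded H (S.toOp hs W) u + ψ = ψ + (lam : ℂ) • (u : X 0) := h1.symm.trans hAu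
      rw [add_comm ψ] at h2
      exact add_right_cancel h2
  · rintro ⟨x, hx0, hx⟩
    have hAlam : A x - (lam : ℂ) • (x : X 0) = P₀ x :=
      sub_eq_iff_eq_add'.2 ((hAx x).trans (congrArg (· + P₀ x) hx))
    have hlim : ∀ f : X s, Tendsto (fun ε : ℝ => inner ℂ (S.emb hs f)
        (resolventOf A (lam + ε * Complex.I) (P₀ x))) (𝓝[>] 0)
        (𝓝 (inner ℂ (S.emb hs f) (x : X 0))) := fun f => by
      have := S.tendsto_inner_resolventOf hs hA hB x f
      rwa [hAlam] at this
    -- otherwise `x` would be an eigenvector of `A`, weakly equal to `R(lam + i 0) 0 = 0`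
    have hPx : P₀ (x : X 0) ≠ 0 := fun h => hx0 <| by
      refine hdense.eq_zero_of_inner_left ℂ fun f => ?_
      have h1 := hlim f
      simp only [h, map_zero, inner_zero_right] at h1
      rw [← inner_conj_symm, tendsto_nhds_unique h1 tendsto_const_nhds, map_zero]
    refine Module.End.hasEigenvalue_of_hasEigenvector (x := P₀ x) ⟨?_, hPx⟩
    rw [Module.End.mem_eigenspace_iff, one_smul]
    refine ext_inner_left ℂ fun g => ?_
    refine tendsto_nhds_unique (hQlim g (P₀ x)) ?_
    have h1 := hlim (T g)
    rw [hT, inner_eigenprojection] at h1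
    rwa [eigenprojection_eigenprojection]

end HilbertScale

theorem propositionP {X : ℝ → Type u} [∀ s, NormedAddCommGroup (X s)]
    [∀ s, InnerProductSpace ℂ (X s)] [∀ s, CompleteSpace (X s)]
    (S : HilbertScale X) (C : S.Conjugation) (H : X 0 →ₗ.[ℂ] X 0)
    (lam₀ s₁ : ℝ) (δ₁ : ℝ → ℝ)
    (h1 : S.H1 C H) (h2 : S.H2 H lam₀) (h3 : S.H3 H lam₀ 1 s₁ δ₁)
    (s : ℝ) (hs0 : 0 ≤ s) (hs : s₁ < s)
    (a b : ℝ) (hJ : Icc a b ⊆ Ioo (lam₀ - δ₁ s) (lam₀ + δ₁ s)) :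
    (∃ γ : ℝ, S.IsThreshold C hs0 H lam₀ 1 (Icc a b) γ) ∧
    ∀ γ : ℝ, S.IsThreshold C hs0 H lam₀ 1 (Icc a b) γ →
      ∀ W : X (-s) →L[ℂ] X s, S.IsPerturbation C hs0 W → ‖W‖ < γ →
        ∀ lam ∈ Icc a b,
          ∃ (B : X s →L[ℂ] X (-s)) (Q : X 0 →L[ℂ] X 0),
            Tendsto (fun ε : ℝ => S.scaleResolvent hs0
              (addBounded (shifted H lam₀) (S.toOp hs0 W)) (lam + ε * Complex.I))
              (𝓝[>] 0) (𝓝 B) ∧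
            Tendsto (fun ε : ℝ => S.Qop hs0 H lam₀ W (lam + ε * Complex.I)) (𝓝[>] 0) (𝓝 Q) ∧
            S.IsCompression hs0 H lam₀ B Q ∧
            (Module.End.HasEigenvalue (Q : X 0 →ₗ[ℂ] X 0) 1 ↔
              IsEigenvalueOf (addBounded H (S.toOp hs0 W)) lam) := by
  have hshift : IsSelfAdjoint (shifted H lam₀) :=
    h1.selfAdjoint.addBounded (isSelfAdjoint_eigenprojection H lam₀)
  refine ⟨?_, fun γ hγ W hW hWγ lam hlam => ?_⟩
  · obtain ⟨γ, hγ, hstab⟩ := S.exists_limitingAbsorption_addBounded hs0 hshift isOpen_Ioo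
      (h3.limit s hs0 hs) isCompact_Icc hJ
    refine ⟨γ, hγ, fun W hW hWγ => ?_⟩
    obtain ⟨V, hV, hJV, hlap⟩ := hstab W hW.selfAdjoint hWγ
    exact S.uniformLimits_of_limitingAbsorption hs0 (hshift.addBounded hW.selfAdjoint) hV hlap
      isCompact_Icc hJV
  · have hA := hshift.addBounded hW.selfAdjoint
    obtain ⟨B, B', hB, hB'⟩ := (hγ.2 W hW hWγ).1.exists_tendsto hs0 hA hlam
    obtain ⟨T, hT⟩ := h2.exists_lift hs0
    have hQ : Tendsto (fun ε : ℝ => S.Qop hs0 H lam₀ W (lam + ε * Complex.I)) (𝓝[>] 0)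
        (𝓝 ((S.pairingAdjoint T).comp (B.comp T))) := by
      have hc : Continuous fun R : X s →L[ℂ] X (-s) => (S.pairingAdjoint T).comp (R.comp T) := by
        fun_prop
      refine ((hc.tendsto _).comp hB).congr fun ε => ?_
      exact (S.Qop_eq hs0 hT W _).symm
    refine ⟨B, _, hB, hQ, ⟨?_, fun f g hf hg => ?_⟩,
      S.hasEigenvalue_one_iff hs0 hA (S.emb_dense (h3.nonneg.trans_lt hs)) hT hB hB' hQ⟩
    · have hc : Continuous fun R : X 0 →L[ℂ] X 0 =>
          (eigenprojection H lam₀).comp (R.comp (eigenprojection H lam₀)) := by fun_prop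
      refine tendsto_nhds_unique ((hc.tendsto _).comp hQ) (hQ.congr fun ε => ?_)
      ext x
      simp only [HilbertScale.Qop, Function.comp_apply, ContinuousLinearMap.comp_apply,
        eigenprojection_eigenprojection]
    · have hTe : ∀ f : X s, S.emb hs0 f ∈ eigenspaceOf H lam₀ → T (S.emb hs0 f) = f :=
        fun f hf => S.emb_injective hs0 ((hT _).trans (eigenprojection_of_mem hf))
      have h := S.inner_pairingAdjoint T (B (T (S.emb hs0 g))) (S.emb hs0 f)
      rw [hTe f hf, hTe g hg] at h
      have e : (S.pairingAdjoint T).comp (B.comp T) (S.emb hs0 g) = S.pairingAdjoint T (B g) := by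
        rw [ContinuousLinearMap.comp_apply, ContinuousLinearMap.comp_apply, hTe g hg]
      rw [e]
      exact h
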